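/- **Chamanara's surface.** For $k\ge 0$ let $I_k=(1-2^{-k},\,1-2^{-k-1})$, $J_k=(2^{-k-1},2^{-k})$, and let $\tau_k=3\cdot 2^{-k-1}-1$, so that $J_k=I_k+\tau_k$. The surface $S$ is obtained from the closed unit square by discarding the corners and the endpoints of the edge intervals below and gluing, for every $k\ge 0$, the interval $\{1\}\times I_k$ of the right edge to $\{0\}\times J_k$ on the left edge by $(1,y)\sim(0,y+\tau_k)$, and $I_k\times\{1\}$ on the top edge to $J_k\times\{0\}$ on the bottom edge by $(x,1)\sim(x+\tau_k,0)$. It carries the translation structure and Lebesgue measure of the square. The translation flow on $S$, and on a cover of $S$ with the lifted structure and lifted Lebesgue measure, is the flow moving to the right with unit speed in local coordinates. It is ergodic if every measurable union of trajectories is null or has null complement. Let $\phi:S\to S$ be the affine automorphism with derivative $\mathrm{diag}(1/2,2)$ given by $\phi(x,y)=(x/2,2y)$ if $y\le 1/2$ and $\phi(x,y)=(x/2+1/2,\,2y-1)$ if $y>1/2$. Let $s_0=(1/8,1/8)$, let $\delta$ be the straight path in the open square from $s_0$ to $\phi^{-1}(s_0)=(1/4,1/16)$, and let $\phi_\delta^{-1}$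 be the automorphism $[\beta]\mapsto[\delta\bullet(\phi^{-1}\circ\beta)\bullet\delta^{-1}]$ of $\pi_1=\pi_1(S,s_0)$, with $n$-th iterate $\phi_\delta^{-n}$. **Spaces of covers.** Let $d\ge 2$, let $\Pi_d$ be the symmetric group on $\{1,\dots,d\}$ and let $G\subset\Pi_d$ be a transitive subgroup. Give $\mathrm{Hom}(\pi_1,G)$ the topology of pointwise convergence ($G$ discrete). A homomorphism $h\in\mathrm{Hom}(\pi_1,G)$ determines, up to isomorphism, a (possibly disconnected) $d$-fold cover $\tilde S_h\to S$ with monodromy $h$. The space of covers with monodromy in $G$ is $\mathrm{Cov}_G=\Pi_d\backslash\mathrm{Hom}(\pi_1,G)$, the quotient space in which homomorphisms conjugate by an element of $\Pi_d$ are identified; $[h]$ denotes the class of $h$. For a subgroup $H\subset G$, $\Pi_d\backslash\mathrm{Hom}(\pi_1,H)\subset \mathrm{Cov}_G$ denotes the set of classes of homomorphisms with values in $H$. Let $\mathcal H$ be the set of subgroups of $G$ that do not act transitively on $\{1,\dots,d\}$. **Theorem (Non-ergodic covers).** (1) Let $h\in\mathrm{Hom}(\pi_1,G)$. If there is an $H\in\mathcal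 H$ such that every accumulation point of the sequence $h\circ\phi_\delta^{-n}$ ($n\to\infty$) in $\mathrm{Hom}(\pi_1,G)$ lies in $\mathrm{Hom}(\pi_1,H)$, then the translation flow on the cover $\tilde S_h$ is not ergodic. (2) For every $H\in\mathcal H$ there is a dense set $D\subset\mathrm{Cov}_G$ such that for every $[h]\in D$ the cover $\tilde S_h$ is connected, every accumulation point of the sequence $[h\circ\phi_\delta^{-n}]$ ($n\to\infty$) in $\mathrm{Cov}_G$ lies in $\Pi_d\backslash\mathrm{Hom}(\pi_1,H)$, and no accumulation point lies in $\Pi_d\backslash\mathrm{Hom}(\pi_1,H')$ for any proper subgroup $H'\subset H$. -/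

import Mathlib

open Set Filter Topology MeasureTheory

noncomputable section

/-! ### The surface

Each edge of the unit square is cut into open intervals of lengths `1/2, 1/4, 1/8, …`.  On the
right and top edges the lengths decrease when moving up, resp. right, and on the left and bottom
edges they decrease when moving down, resp. left.  The vertical edge labelled `k + 1` and the
horizontal edge labelled `-k` have length `1 / 2 ^ (k + 1)`. -/

namespace Chamanara

/-- The coordinate interval of length `1 / 2 ^ (k + 1)` on the right or top edge. -/
def farInterval (k : ℕ) : Set ℝ := Ioo (1 - (1 / 2) ^ k) (1 - (1 / 2) ^ (k + 1))

/-- The coordinate interval of length `1 / 2 ^ (k + 1)` on the left or bottom edge. -/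
def nearInterval (k : ℕ) : Set ℝ := Ioo ((1 / 2) ^ (k + 1)) ((1 / 2) ^ k)

/-- The translation that carries `farInterval k` onto `nearInterval k`. -/
def shift (k : ℕ) : ℝ := 3 * (1 / 2) ^ (k + 1) - 1

/-- The closed unit square without its corners and the endpoints of the edge intervals. -/
def square : Set (ℝ × ℝ) :=
  {z | (z.1 ∈ Ioo 0 1 ∧ z.2 ∈ Ioo 0 1) ∨
    (∃ k, z.1 = 1 ∧ z.2 ∈ farInterval k) ∨ (∃ k, z.1 = 0 ∧ z.2 ∈ nearInterval k) ∨
    (∃ k, z.2 = 1 ∧ z.1 ∈ farInterval k) ∨ (∃ k, z.2 = 0 ∧ z.1 ∈ nearInterval k)}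

/-- The edge identifications: intervals of equal length on the right and left edges, and on the
top and bottom edges, are glued by translation. -/
def Glue (z w : square) : Prop :=
  ∃ k, (z.1.1 = 1 ∧ z.1.2 ∈ farInterval k ∧ w.1.1 = 0 ∧ w.1.2 = z.1.2 + shift k) ∨
    (z.1.2 = 1 ∧ z.1.1 ∈ farInterval k ∧ w.1.2 = 0 ∧ w.1.1 = z.1.1 + shift k)

/-- Chamanara's surface, with the quotient topology. -/
def Surface : Type := Quot Glue

instance : TopologicalSpace Surface := inferInstanceAs (TopologicalSpace (Quot Glue))

instance : MeasurableSpace Surface := borel Surface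

instance : BorelSpace Surface := ⟨rfl⟩

theorem interior_mem {x y : ℝ} (hx : x ∈ Ioo (0 : ℝ) 1) (hy : y ∈ Ioo (0 : ℝ) 1) :
    (x, y) ∈ square := Or.inl ⟨hx, hy⟩

open Classical in
/-- The point of the surface represented by a point of the square (a dummy value is used outside
the square). -/
def pt (z : ℝ × ℝ) : Surface :=
  if h : z ∈ square then Quot.mk Glue ⟨z, h⟩
  else Quot.mk Glue ⟨(1 / 8, 1 / 8), interior_mem (by norm_num) (by norm_num)⟩

/-- Lebesgue measure on the surface: the image of Lebesgue measure on the square. -/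
def area : Measure Surface := (volume.restrict square).map pt

/-- The basepoint, in the interior of the square near the southwest corner. -/
def basepoint : Surface := pt (1 / 8, 1 / 8)

theorem pt_mk (z : square) : pt z.1 = (Quot.mk Glue z : Surface) := by
  exact dif_pos z.2

theorem continuousOn_pt : ContinuousOn pt square := by
  rw [continuousOn_iff_continuous_domRestrict]
  have : square.domRestrict pt = fun z : square => (Quot.mk Glue z : Surface) := by
    funext z; exact pt_mk z
  rw [this]
  exact continuous_quot_mk

theorem exists_pt (s : Surface) : ∃ z ∈ square, pt z = s := by
  induction s using Quot.ind with
  | mk z => exact ⟨z.1, z.2, pt_mk z⟩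

theorem pow_half_pos (k : ℕ) : (0 : ℝ) < (1 / 2) ^ k := by positivity

theorem pow_half_le_one (k : ℕ) : ((1 : ℝ) / 2) ^ k ≤ 1 := pow_le_one₀ (by norm_num) (by norm_num)

theorem near_of_far {k : ℕ} {y : ℝ} (hy : y ∈ farInterval k) : y + shift k ∈ nearInterval k := by
  simp only [farInterval, nearInterval, shift, mem_Ioo, pow_succ] at *
  constructor <;> linarith [hy.1, hy.2]

theorem pt_vertical {k : ℕ} {y y' : ℝ} (hy : y ∈ farInterval k) (h : y' = y + shift k) :
    pt (1, y) = pt (0, y') := by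
  subst h
  have h1 : ((1 : ℝ), y) ∈ square := Or.inr (Or.inl ⟨k, rfl, hy⟩)
  have h2 : ((0 : ℝ), y + shift k) ∈ square := Or.inr (Or.inr (Or.inl ⟨k, rfl, near_of_far hy⟩))
  have := pt_mk ⟨_, h1⟩
  have h3 := pt_mk ⟨_, h2⟩
  simp only at this h3
  rw [this, h3]
  exact Quot.sound ⟨k, Or.inl ⟨rfl, hy, rfl, rfl⟩⟩

theorem pt_horizontal {k : ℕ} {x x' : ℝ} (hx : x ∈ farInterval k) (h : x' = x + shift k) :
    pt (x, 1) = pt (x', 0) := by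
  subst h
  have h1 : (x, (1 : ℝ)) ∈ square := Or.inr (Or.inr (Or.inr (Or.inl ⟨k, rfl, hx⟩)))
  have h2 : (x + shift k, (0 : ℝ)) ∈ square :=
    Or.inr (Or.inr (Or.inr (Or.inr ⟨k, rfl, near_of_far hx⟩)))
  have := pt_mk ⟨_, h1⟩
  have h3 := pt_mk ⟨_, h2⟩
  simp only at this h3
  rw [this, h3]
  exact Quot.sound ⟨k, Or.inr ⟨rfl, hx, rfl, rfl⟩⟩

/-! ### The affine automorphism

Its derivative is `diag (1/2, 2)`.  The image of the unit square is the rectangle of width `1/2`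
and height `2` whose lower half is the left half of the square, and whose upper half is reached
by passing through the top edge labelled `0`, i.e. is the right half of the square. -/

/-- The affine automorphism in the coordinates of the square. -/
def phiAux (z : ℝ × ℝ) : Surface :=
  if z.2 ≤ 1 / 2 then pt (z.1 / 2, 2 * z.2) else pt (z.1 / 2 + 1 / 2, 2 * z.2 - 1)

theorem lower_mem {z : ℝ × ℝ} (hz : z ∈ square) (h : z.2 ≤ 1 / 2) :
    (z.1 / 2, 2 * z.2) ∈ square := by
  obtain ⟨x, y⟩ := z
  simp only at h
  rcases hz with ⟨hx, hy⟩ | ⟨k, hx, hy⟩ | ⟨k, hx, hy⟩ | ⟨k, hy, hx⟩ | ⟨k, hy, hx⟩ <;>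
    simp only [farInterval, nearInterval, mem_Ioo] at hx hy
  · rcases h.lt_or_eq with h | h
    · exact interior_mem ⟨by linarith [hx.1], by linarith [hx.2]⟩
        ⟨by linarith [hy.1], by linarith⟩
    · refine Or.inr (Or.inr (Or.inr (Or.inl ⟨0, by simp [h], ?_⟩)))
      simp only [farInterval, mem_Ioo]
      norm_num
      constructor <;> linarith [hx.1, hx.2]
  · subst hx
    have h0 : 0 < y := by linarith [pow_half_le_one k]
    cases k with
    | zero => exact interior_mem (by norm_num) ⟨by linarith, by norm_num at hy; linarith [hy.2]⟩
    | succ k =>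
      exfalso
      have := pow_half_le_one k
      rw [pow_succ] at hy
      linarith [hy.1]
  · subst hx
    cases k with
    | zero => exfalso; norm_num at hy; linarith [hy.1]
    | succ k =>
      refine Or.inr (Or.inr (Or.inl ⟨k, by simp, ?_⟩))
      simp only [nearInterval, mem_Ioo]
      simp only [pow_succ] at hy ⊢
      constructor <;> linarith [hy.1, hy.2]
  · exfalso; linarith
  · subst hy
    refine Or.inr (Or.inr (Or.inr (Or.inr ⟨k + 1, by simp, ?_⟩)))
    simp only [nearInterval, mem_Ioo]
    simp only [pow_succ] at hx ⊢
    constructor <;> linarith [hx.1, hx.2]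

theorem upper_mem {z : ℝ × ℝ} (hz : z ∈ square) (h : 1 / 2 ≤ z.2) :
    (z.1 / 2 + 1 / 2, 2 * z.2 - 1) ∈ square := by
  obtain ⟨x, y⟩ := z
  simp only at h
  rcases hz with ⟨hx, hy⟩ | ⟨k, hx, hy⟩ | ⟨k, hx, hy⟩ | ⟨k, hy, hx⟩ | ⟨k, hy, hx⟩ <;>
    simp only [farInterval, nearInterval, mem_Ioo] at hx hy
  · rcases h.lt_or_eq with h | h
    · exact interior_mem ⟨by linarith [hx.1], by linarith [hx.2]⟩
        ⟨by linarith, by linarith [hy.2]⟩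
    · refine Or.inr (Or.inr (Or.inr (Or.inr ⟨0, by simp [← h], ?_⟩)))
      simp only [nearInterval, mem_Ioo]
      norm_num
      constructor <;> linarith [hx.1, hx.2]
  · subst hx
    cases k with
    | zero => exfalso; norm_num at hy; linarith [hy.2]
    | succ k =>
      refine Or.inr (Or.inl ⟨k, by norm_num, ?_⟩)
      simp only [farInterval, mem_Ioo]
      simp only [pow_succ] at hy ⊢
      constructor <;> linarith [hy.1, hy.2]
  · subst hx
    cases k with
    | zero =>
      norm_num at hy
      exact interior_mem (by norm_num) ⟨by linarith [hy.1], by linarith [hy.2]⟩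
    | succ k =>
      exfalso
      have := pow_half_le_one k
      rw [pow_succ (n := k)] at hy
      linarith [hy.2]
  · subst hy
    refine Or.inr (Or.inr (Or.inr (Or.inl ⟨k + 1, by norm_num, ?_⟩)))
    simp only [farInterval, mem_Ioo]
    simp only [pow_succ] at hx ⊢
    constructor <;> linarith [hx.1, hx.2]
  · exfalso; linarith

theorem phiAux_agree {x : ℝ} (hx : (x, (1 / 2 : ℝ)) ∈ square) :
    pt (x / 2, 1) = pt (x / 2 + 1 / 2, 0) := by
  have hx' : x ∈ Ioo (0 : ℝ) 1 := by
    rcases hx with ⟨hx, hy⟩ | ⟨k, hx, hy⟩ | ⟨k, hx, hy⟩ | ⟨k, hy, hx⟩ | ⟨k, hy, hx⟩ <;>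
      simp only [farInterval, nearInterval, mem_Ioo] at hx hy
    · exact hx
    · exfalso
      cases k with
      | zero => norm_num at hy
      | succ k =>
        have := pow_half_le_one k
        rw [pow_succ (n := k)] at hy
        linarith [hy.1]
    · exfalso
      cases k with
      | zero => norm_num at hy
      | succ k =>
        have := pow_half_le_one k
        rw [pow_succ (n := k)] at hy
        linarith [hy.2]
    · norm_num at hy
    · norm_num at hy
  refine pt_horizontal (k := 0) ?_ ?_
  · simp only [farInterval, mem_Ioo]
    norm_num
    constructor <;> linarith [hx'.1, hx'.2]
  · norm_num [shift]

theorem continuousOn_phiAux : ContinuousOn phiAux square := by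
  have hcl : IsClosed {z : ℝ × ℝ | z.2 ≤ 1 / 2} := isClosed_le continuous_snd continuous_const
  have hcl2 : closure {z : ℝ × ℝ | ¬ z.2 ≤ 1 / 2} ⊆ {z : ℝ × ℝ | 1 / 2 ≤ z.2} := by
    refine closure_minimal (fun z hz => ?_) (isClosed_le continuous_const continuous_snd)
    simp only [mem_ofPred_eq, not_le] at hz ⊢
    exact hz.le
  unfold phiAux
  refine ContinuousOn.if ?_ ?_ ?_
  · rintro ⟨x, y⟩ ⟨hz, hf⟩
    have h1 : y = 1 / 2 := by
      have := frontier_le_subset_eq (continuous_snd (X := ℝ) (Y := ℝ)) continuous_const hf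
      simpa using this
    subst h1
    have := phiAux_agree hz
    norm_num at this ⊢
    exact this
  · refine continuousOn_pt.comp (by fun_prop) ?_
    rintro z ⟨hz, hz'⟩
    rw [hcl.closure_eq] at hz'
    exact lower_mem hz hz'
  · refine continuousOn_pt.comp (by fun_prop) ?_
    rintro z ⟨hz, hz'⟩
    exact upper_mem hz (hcl2 hz')

theorem phiAux_glue (z w : square) (h : Glue z w) : phiAux z.1 = phiAux w.1 := by
  obtain ⟨⟨x, y⟩, hz⟩ := z
  obtain ⟨⟨x', y'⟩, hw⟩ := w
  obtain ⟨k, ⟨h1, h2, h3, h4⟩ | ⟨h1, h2, h3, h4⟩⟩ := h <;> simp only at h1 h2 h3 h4 ⊢ <;>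
    subst h1 h3 h4
  · have h5 := near_of_far h2
    simp only [farInterval, nearInterval, mem_Ioo] at h2 h5
    cases k with
    | zero =>
      norm_num at h2 h5
      unfold phiAux
      rw [if_pos (by simp only; linarith), if_neg (by simp only [not_le]; linarith)]
      congr 1
      ext <;> norm_num [shift]
      ring
    | succ k =>
      have := pow_half_le_one k
      rw [pow_succ (n := k)] at h2 h5
      unfold phiAux
      rw [if_neg (by simp only [not_le]; linarith [h2.1, h2.2]),
        if_pos (by simp only; linarith [h5.1, h5.2])]
      norm_num only
      refine pt_vertical (k := k) ?_ ?_
      · simp only [farInterval, mem_Ioo]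
        simp only [pow_succ] at h2 ⊢
        constructor <;> linarith [h2.1, h2.2]
      · simp only [shift, pow_succ]; ring
  · unfold phiAux
    rw [if_neg (by norm_num), if_pos (by norm_num)]
    norm_num only
    refine pt_horizontal (k := k + 1) ?_ ?_
    · simp only [farInterval, mem_Ioo] at h2 ⊢
      simp only [pow_succ] at h2 ⊢
      constructor <;> linarith [h2.1, h2.2]
    · simp only [shift, pow_succ]; ring

/-- The affine automorphism as a map of the surface. -/
def phiFun : Surface → Surface := Quot.lift (fun z : square => phiAux z.1) phiAux_glue

theorem phiFun_pt {z : ℝ × ℝ} (hz : z ∈ square) : phiFun (pt z) = phiAux z := by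
  have := pt_mk ⟨z, hz⟩
  simp only at this
  rw [this]
  rfl

theorem continuous_phiFun : Continuous phiFun :=
  continuous_quot_lift _ (continuousOn_iff_continuous_domRestrict.mp continuousOn_phiAux)

theorem swap_mem {z : ℝ × ℝ} (hz : z ∈ square) : z.swap ∈ square := by
  rcases hz with ⟨hx, hy⟩ | h | h | h | h
  · exact Or.inl ⟨hy, hx⟩
  · exact Or.inr (Or.inr (Or.inr (Or.inl h)))
  · exact Or.inr (Or.inr (Or.inr (Or.inr h)))
  · exact Or.inr (Or.inl h)
  · exact Or.inr (Or.inr (Or.inl h))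

/-- The reflection of the surface in the diagonal of the square. -/
def diagFlip : Surface → Surface :=
  Quot.map (fun z : square => (⟨z.1.swap, swap_mem z.2⟩ : square))
    (fun _ _ ⟨k, h⟩ => ⟨k, h.symm⟩)

theorem diagFlip_pt {z : ℝ × ℝ} (hz : z ∈ square) : diagFlip (pt z) = pt z.swap := by
  have h1 := pt_mk ⟨z, hz⟩
  have h2 := pt_mk ⟨z.swap, swap_mem hz⟩
  simp only at h1 h2
  rw [h1, h2]
  rfl

theorem diagFlip_diagFlip (s : Surface) : diagFlip (diagFlip s) = s := by
  obtain ⟨z, hz, rfl⟩ := exists_pt s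
  rw [diagFlip_pt hz, diagFlip_pt (swap_mem hz), Prod.swap_swap]

theorem continuous_diagFlip : Continuous diagFlip := by
  refine continuous_quot_lift _ (continuous_quot_mk.comp ?_)
  exact Continuous.subtype_mk (continuous_swap.comp continuous_subtype_val) _

theorem diagFlip_phi_diagFlip_phi (s : Surface) : diagFlip (phiFun (diagFlip (phiFun s))) = s := by
  obtain ⟨⟨x, y⟩, hz, rfl⟩ := exists_pt s
  rw [phiFun_pt hz]
  have hx : 0 ≤ x ∧ x ≤ 1 := by
    rcases hz with ⟨hx, hy⟩ | ⟨k, hx, hy⟩ | ⟨k, hx, hy⟩ | ⟨k, hy, hx⟩ | ⟨k, hy, hx⟩ <;>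
      simp only [farInterval, nearInterval, mem_Ioo] at hx hy
    · exact ⟨hx.1.le, hx.2.le⟩
    · subst hx; norm_num
    · subst hx; norm_num
    · exact ⟨by linarith [pow_half_le_one k], by linarith [pow_half_pos (k + 1)]⟩
    · exact ⟨by linarith [pow_half_pos (k + 1)], by linarith [pow_half_le_one k]⟩
  by_cases h : y ≤ 1 / 2
  · have hm := lower_mem hz h
    simp only at hm
    rw [phiAux, if_pos h, diagFlip_pt hm, phiFun_pt (swap_mem hm), phiAux,
      if_pos (by simp only [Prod.snd_swap]; linarith)]
    have e : ((x / 2, 2 * y).swap.1 / 2, 2 * (x / 2, 2 * y).swap.2) = (y, x) := by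
      ext <;> simp <;> ring
    rw [e]
    exact diagFlip_pt (swap_mem hz)
  · have h' : 1 / 2 ≤ y := (not_le.mp h).le
    have hm := upper_mem hz h'
    simp only at hm
    rw [phiAux, if_neg h, diagFlip_pt hm, phiFun_pt (swap_mem hm), phiAux]
    split_ifs with h0
    · simp only [Prod.snd_swap] at h0
      have hx0 : x = 0 := by linarith
      subst hx0
      have hy : 1 / 2 < y ∧ y < 1 := by
        refine ⟨not_le.mp h, ?_⟩
        rcases hz with ⟨hx, hy⟩ | ⟨k, hx, hy⟩ | ⟨k, hx, hy⟩ | ⟨k, hy, hx⟩ | ⟨k, hy, hx⟩ <;>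
          simp only [farInterval, nearInterval, mem_Ioo] at hx hy
        · exact hy.2
        · norm_num at hx
        · linarith [pow_half_le_one k]
        · linarith [pow_half_le_one k]
        · linarith
      have hf : y - 1 / 2 ∈ farInterval 0 := by
        simp only [farInterval, mem_Ioo]
        norm_num
        constructor <;> linarith [hy.1, hy.2]
      have e : (((0 : ℝ) / 2 + 1 / 2, 2 * y - 1).swap.1 / 2,
          2 * ((0 : ℝ) / 2 + 1 / 2, 2 * y - 1).swap.2) = (y - 1 / 2, 1) := by
        ext <;> simp <;> ring
      rw [e, diagFlip_pt (Or.inr (Or.inr (Or.inr (Or.inl ⟨0, rfl, hf⟩))))]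
      refine pt_vertical hf ?_
      norm_num [shift]
    · have e : ((x / 2 + 1 / 2, 2 * y - 1).swap.1 / 2 + 1 / 2,
          2 * (x / 2 + 1 / 2, 2 * y - 1).swap.2 - 1) = (y, x) := by
        ext <;> simp <;> ring
      rw [e]
      exact diagFlip_pt (swap_mem hz)

/-- The affine automorphism `φ` with derivative `diag (1/2, 2)`. -/
def phi : Surface ≃ₜ Surface where
  toFun := phiFun
  invFun s := diagFlip (phiFun (diagFlip s))
  left_inv := diagFlip_phi_diagFlip_phi
  right_inv s := by
    have := diagFlip_phi_diagFlip_phi (diagFlip s)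
    rw [← diagFlip_diagFlip (phiFun (diagFlip (phiFun (diagFlip s)))), this, diagFlip_diagFlip]
  continuous_toFun := continuous_phiFun
  continuous_invFun := continuous_diagFlip.comp (continuous_phiFun.comp continuous_diagFlip)

theorem basepoint_mem : ((1 : ℝ) / 8, (1 : ℝ) / 8) ∈ square :=
  interior_mem (by norm_num) (by norm_num)

theorem phi_symm_basepoint : phi.symm basepoint = pt (1 / 4, 1 / 16) := by
  change diagFlip (phiFun (diagFlip (pt (1 / 8, 1 / 8)))) = _
  rw [diagFlip_pt basepoint_mem, phiFun_pt (swap_mem basepoint_mem), phiAux,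
    if_pos (by norm_num)]
  norm_num only [Prod.swap]
  rw [diagFlip_pt (interior_mem (by norm_num) (by norm_num))]
  rfl

/-! ### The fundamental group and the action of the affine automorphism -/

/-- The straight path, inside the open square, from the basepoint to its image under `φ⁻¹`. -/
def delta : Path basepoint (phi.symm basepoint) where
  toFun t := pt ((1 + (t : ℝ)) / 8, (2 - (t : ℝ)) / 16)
  continuous_toFun := by
    refine continuousOn_pt.comp_continuous (by fun_prop) (fun t => ?_)
    have h0 := t.2.1
    have h1 := t.2.2
    exact interior_mem ⟨by linarith, by linarith⟩ ⟨by linarith, by linarith⟩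
  source' := by norm_num [basepoint]
  target' := by rw [phi_symm_basepoint]; norm_num

/-- The fundamental group of the surface. -/
abbrev Pi1 : Type := FundamentalGroup Surface basepoint

/-- The automorphism `[β] ↦ [δ • (φ⁻¹ ∘ β) • δ⁻¹]` of the fundamental group. -/
def phiInvDelta : Pi1 →* Pi1 :=
  (FundamentalGroup.fundamentalGroupMulEquivOfPath delta).symm.toMonoidHom.comp
    (FundamentalGroup.map (phi.symm : C(Surface, Surface)) basepoint)

theorem phiInvDelta_mk (β : Path basepoint basepoint) :
    phiInvDelta (FundamentalGroup.fromPath (Path.Homotopic.Quotient.mk β)) =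
      FundamentalGroup.fromPath (Path.Homotopic.Quotient.mk
        (delta.trans ((β.map phi.symm.continuous).trans delta.symm))) := by
  rfl

/-! ### Spaces of covers -/

section Covers

variable {d : ℕ} (G : Subgroup (Equiv.Perm (Fin d)))

/-- The topology of pointwise convergence on `Hom(π₁, G)`, with `G` discrete. -/
instance homTopology : TopologicalSpace (Pi1 →* G) :=
  TopologicalSpace.induced (fun h γ => h γ) (@Pi.topologicalSpace Pi1 (fun _ => G) (fun _ => ⊥))

/-- Two homomorphisms to `G` are equivalent if a permutation of the `d` letters (not necessarily
in `G`) conjugates one to the other. -/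
def conjSetoid : Setoid (Pi1 →* G) where
  r h k := ∃ σ : Equiv.Perm (Fin d), ∀ γ, (k γ : Equiv.Perm (Fin d)) = σ * h γ * σ⁻¹
  iseqv :=
    { refl := fun h => ⟨1, fun γ => by simp⟩
      symm := fun {h k} ⟨σ, hσ⟩ => ⟨σ⁻¹, fun γ => by rw [hσ]; group⟩
      trans := fun {h k l} ⟨σ, hσ⟩ ⟨τ, hτ⟩ => ⟨τ * σ, fun γ => by rw [hτ, hσ]; group⟩ }

/-- The space of `d`-fold covers of the surface with monodromy in `G`. -/
def Cov : Type := Quotient (conjSetoid G)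

instance : TopologicalSpace (Cov G) := inferInstanceAs (TopologicalSpace (Quotient (conjSetoid G)))

variable {G}

/-- The class in the space of covers of a homomorphism. -/
def Cov.mk (h : Pi1 →* G) : Cov G := Quotient.mk (conjSetoid G) h

/-- The homomorphism `h` takes its values in the subgroup `H`. -/
def ValuedIn (H : Subgroup (Equiv.Perm (Fin d))) (h : Pi1 →* G) : Prop :=
  ∀ γ, (h γ : Equiv.Perm (Fin d)) ∈ H

/-- The subset `Π_d \ Hom(π₁, H)` of the space of covers with monodromy in `G`. -/
def covIn (G H : Subgroup (Equiv.Perm (Fin d))) : Set (Cov G) :=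
  {c | ∃ h : Pi1 →* G, ValuedIn H h ∧ Cov.mk h = c}

/-- The homomorphism `h ∘ φ_δ⁻ⁿ`. -/
def iter (h : Pi1 →* G) (n : ℕ) : Pi1 →* G :=
  (fun k : Pi1 →* G => k.comp phiInvDelta)^[n] h

/-- `p : E → S` is a covering map whose fiber over the basepoint can be labelled by `d` letters so
that the monodromy is `h`.  In the fundamental group of Mathlib the product `γ * γ'` is `γ'`
followed by `γ`, so that `γ` acting on the fiber by lifting paths is a left action; composition
with inversion passes to the convention of path concatenation. -/
def IsCoverOf {E : Type*} [TopologicalSpace E] (p : E → Surface)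
    (h : Pi1 →* Equiv.Perm (Fin d)) : Prop :=
  ∃ (hp : IsCoveringMap p) (label : Fin d ≃ p ⁻¹' {basepoint}),
    ∀ (γ : Pi1) (i : Fin d), hp.monodromyPerm basepoint γ (label i) = label (h γ i)

/-- The cover with monodromy `h` is connected. -/
def IsConnectedCover (h : Pi1 →* Equiv.Perm (Fin d)) : Prop :=
  ∃ (E : Type) (_ : TopologicalSpace E) (p : E → Surface), IsCoverOf p h ∧ ConnectedSpace E

end Covers

/-! ### The translation flow on a cover -/

/-- Index set for an atlas of the translation structure on the surface: one chart for the open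
square, and one across the gluing of each pair of edge intervals. -/
inductive Chart
  | interior
  | vertical (k : ℕ)
  | horizontal (k : ℕ)

/-- The open subset of the plane that is the image of a chart. -/
def Chart.dom : Chart → Set (ℝ × ℝ)
  | interior => Ioo 0 1 ×ˢ Ioo 0 1
  | vertical k => Ioo 0 2 ×ˢ farInterval k
  | horizontal k => farInterval k ×ˢ Ioo 0 2

/-- The inverse of a chart, from a subset of the plane to the surface. -/
def Chart.param : Chart → ℝ × ℝ → Surface
  | interior, z => pt z
  | vertical k, z => if z.1 ≤ 1 then pt z else pt (z.1 - 1, z.2 + shift k)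
  | horizontal k, z => if z.2 ≤ 1 then pt z else pt (z.1 + shift k, z.2 - 1)

/-- On `[0, T]` the curve `c` moves to the right with unit speed in local coordinates. -/
def IsHorizontal (c : ℝ → Surface) (T : ℝ) : Prop :=
  ∀ t ∈ Icc 0 T, ∃ (χ : Chart) (z : ℝ × ℝ), z ∈ χ.dom ∧
    ∀ᶠ s in 𝓝[Icc 0 T] t, c s = χ.param (z.1 + (s - t), z.2)

section Flow

variable {E : Type*} [TopologicalSpace E] (p : E → Surface)

/-- The (partially defined) translation flow on a cover, for the translation structure lifted
along `p`: the time-`T` map is defined at `x` and takes `x` to `y`. -/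
def FlowsTo (T : ℝ) (x y : E) : Prop :=
  0 ≤ T ∧ ∃ c : ℝ → E, ContinuousOn c (Icc 0 T) ∧ IsHorizontal (p ∘ c) T ∧ c 0 = x ∧ c T = y

variable [MeasurableSpace E]

/-- Lebesgue measure on a cover: the measure of `A` is the integral over the surface of the number
of points of `A` in the fiber. -/
def coverArea : Measure E :=
  area.bind fun s => Measure.count.restrict (p ⁻¹' {s})

/-- Ergodicity of the translation flow on a cover: a measurable set that is a union of flow
trajectories has zero measure or full measure. -/
def IsErgodic : Prop :=
  ∀ A : Set E, MeasurableSet A →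
    (∀ (T : ℝ) (x y : E), FlowsTo p T x y → (x ∈ A ↔ y ∈ A)) →
    coverArea p A = 0 ∨ coverArea p Aᶜ = 0

end Flow

end Chamanara

end

open Chamanara

noncomputable section

namespace Chamanara

/-! ### Charts of the surface -/

/-! Cut along its edges, the surface is an open square, so its fundamental group is free on the
loops `v_k`, `h_k` that cross one vertical or one horizontal edge. Generation follows by cutting a
path into pieces inside charts. Freeness follows by building, for any assignment of permutations to
the edges, a bundle with that monodromy. Since `φ⁻¹` doubles widths and halves heights, one can read
off its action (with the later path on the left): `v_k ↦ v_{k+1} v_0`, `h_{k+1} ↦ h_k v_0`, `h_0 ↦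
v_0⁻¹` (`phiInvDelta_gen_vertical` and its companions).

Everything rests on the orbit `orb n = φ_δ⁻ⁿ(h_0)`. Unwinding the recursion gives `v_k = orb(k+1)⁻¹
orb(k) ⋯ orb(1)` (`gen_vertical_eq`). Hence the `orb n` with `n ≥ 1` and the `h_k` again generate
freely, and `h ↦ h ∘ φ_δ⁻¹` acts on the sequence `h(orb n)` as a shift.

Non-ergodicity. `Hom(π₁, G)` is compact, so if all accumulation points take values in `H`, then
`h(orb n) ∈ H` for every `n ≥ N` (`exists_forall_orb_mem`). Therefore `h ∘ φ_δ⁻ᴺ` sends every `v_k`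
into `H`. It is the monodromy of the same total space projected by `φᴺ ∘ p`, and this change of
projection only rescales the time of the flow. A horizontal trajectory never crosses a horizontal
edge, so its sheet changes only by elements of `H`. The points whose sheet lies in one `H`-orbit
form an invariant open set; as `H` is not transitive, neither this set nor its complement is null
(`not_isErgodic`).

Density. A neighbourhood of `h₀` constrains finitely many generators only. Beyond them, let `h(orb
n)` run periodically through `H` and `h(h_k)` through `G`. The second choice makes the cover
connected. The first sends every fixed element of the group eventually into `H`, and in every window
of bounded length it exhibits all of `H`, so that no limit is conjugate into a smaller group
(`exists_dense_covers`). -/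

theorem square_bounds {z : ℝ × ℝ} (hz : z ∈ square) : 0 ≤ z.1 ∧ z.1 ≤ 1 ∧ 0 ≤ z.2 ∧ z.2 ≤ 1 := by
  have h1 := pow_half_pos
  have h2 := pow_half_le_one
  rcases hz with ⟨hx, hy⟩ | ⟨k, hx, hy⟩ | ⟨k, hx, hy⟩ | ⟨k, hy, hx⟩ | ⟨k, hy, hx⟩ <;>
    simp only [farInterval, nearInterval, mem_Ioo] at hx hy
  · exact ⟨hx.1.le, hx.2.le, hy.1.le, hy.2.le⟩
  all_goals
    have := h1 (k + 1)
    have := h2 k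
    refine ⟨?_, ?_, ?_, ?_⟩ <;> linarith

theorem pow_half_lt {j k : ℕ} (h : j < k) : ((1 : ℝ) / 2) ^ k ≤ (1 / 2) ^ (j + 1) :=
  pow_le_pow_of_le_one (by norm_num) (by norm_num) h

theorem far_bounds {k : ℕ} {y : ℝ} (hy : y ∈ farInterval k) : 0 < y ∧ y < 1 := by
  have h1 := pow_half_pos (k + 1)
  have h2 := pow_half_le_one k
  simp only [farInterval, mem_Ioo] at hy
  constructor <;> linarith

theorem near_bounds {k : ℕ} {y : ℝ} (hy : y ∈ nearInterval k) : 0 < y ∧ y < 1 := by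
  have h1 := pow_half_pos (k + 1)
  have h2 := pow_half_le_one k
  simp only [nearInterval, mem_Ioo] at hy
  constructor <;> linarith

theorem far_unique {j k : ℕ} {y : ℝ} (hj : y ∈ farInterval j) (hk : y ∈ farInterval k) :
    j = k := by
  simp only [farInterval, mem_Ioo] at hj hk
  rcases lt_trichotomy j k with h | h | h
  · linarith [pow_half_lt h]
  · exact h
  · linarith [pow_half_lt h]

theorem near_iff_far {k : ℕ} {y : ℝ} : y + shift k ∈ nearInterval k ↔ y ∈ farInterval k := by
  simp only [farInterval, nearInterval, shift, mem_Ioo, pow_succ]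
  constructor <;> rintro ⟨h1, h2⟩ <;> constructor <;> linarith

theorem near_unique {j k : ℕ} {y : ℝ} (hj : y ∈ nearInterval j) (hk : y ∈ nearInterval k) :
    j = k := by
  simp only [nearInterval, mem_Ioo] at hj hk
  rcases lt_trichotomy j k with h | h | h
  · linarith [pow_half_lt h]
  · exact h
  · linarith [pow_half_lt h]

theorem near_lt_half {k : ℕ} {y : ℝ} (hy : y ∈ nearInterval (k + 1)) : y < 1 / 2 := by
  have := pow_half_lt (Nat.succ_pos k)
  simp only [nearInterval, mem_Ioo] at hy
  norm_num at this hy ⊢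
  linarith [hy.2]

theorem half_lt_far {k : ℕ} {y : ℝ} (hy : y ∈ farInterval (k + 1)) : 1 / 2 < y := by
  have := pow_half_lt (Nat.succ_pos k)
  simp only [farInterval, mem_Ioo] at hy
  norm_num at this hy ⊢
  linarith [hy.1]

theorem far_zero {y : ℝ} : y ∈ farInterval 0 ↔ 0 < y ∧ y < 1 / 2 := by
  simp only [farInterval, mem_Ioo]
  norm_num

theorem near_zero {y : ℝ} : y ∈ nearInterval 0 ↔ 1 / 2 < y ∧ y < 1 := by
  simp only [nearInterval, mem_Ioo]
  norm_num

/-- Glued intervals lie at disjoint positions on opposite edges. This keeps the two halves of an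
edge chart from overlapping in the square. -/
theorem far_disjoint_near {k : ℕ} {y : ℝ} (hj : y ∈ farInterval k) (hk : y ∈ nearInterval k) :
    False := by
  cases k with
  | zero => rw [far_zero] at hj; rw [near_zero] at hk; linarith
  | succ k => linarith [half_lt_far hj, near_lt_half hk]

theorem Chart.isOpen_dom (χ : Chart) : IsOpen χ.dom := by
  cases χ
  · exact isOpen_Ioo.prod isOpen_Ioo
  · exact isOpen_Ioo.prod isOpen_Ioo
  · exact isOpen_Ioo.prod isOpen_Ioo

theorem Chart.convex_dom (χ : Chart) : Convex ℝ χ.dom := by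
  cases χ
  · exact (convex_Ioo _ _).prod (convex_Ioo _ _)
  · exact (convex_Ioo _ _).prod (convex_Ioo _ _)
  · exact (convex_Ioo _ _).prod (convex_Ioo _ _)

/-- The part of the domain of an edge chart that lies strictly beyond the edge. -/
def Chart.Beyond : Chart → ℝ × ℝ → Prop
  | interior, _ => False
  | vertical _, z => 1 < z.1
  | horizontal _, z => 1 < z.2

/-- The part of the domain of a chart that lies strictly before the edge. -/
def Chart.Before : Chart → ℝ × ℝ → Prop
  | interior, _ => True
  | vertical _, z => z.1 < 1
  | horizontal _, z => z.2 < 1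

/-- The open subset of the surface parametrized by a chart. -/
def Chart.carrier (χ : Chart) : Set Surface := χ.param '' χ.dom

/-- A predicate constant along `Glue` descends to the quotient, so points can be separated without
describing the equivalence relation that `Glue` generates. -/
theorem mem_iff_of_pt_eq {X : Set (ℝ × ℝ)} (hX : ∀ z w : square, Glue z w → (z.1 ∈ X ↔ w.1 ∈ X))
    {z w : ℝ × ℝ} (hz : z ∈ square) (hw : w ∈ square) (h : pt z = pt w) : z ∈ X ↔ w ∈ X := by
  have h1 := pt_mk ⟨z, hz⟩
  have h2 := pt_mk ⟨w, hw⟩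
  simp only at h1 h2
  rw [h1, h2] at h
  have := congrArg (Quot.lift (fun z : square => z.1 ∈ X) fun z w hzw => propext (hX z w hzw)) h
  exact iff_of_eq this

theorem isOpen_of_saturated {X : Set (ℝ × ℝ)} {U : Set Surface}
    (hXo : IsOpen X) (h : ∀ w ∈ square, pt w ∈ U ↔ w ∈ X) : IsOpen U := by
  have hU : IsOpen ((fun w : square => pt w.1) ⁻¹' U) := by
    have : (fun w : square => pt w.1) ⁻¹' U = Subtype.val ⁻¹' X := by
      ext w
      exact h w.1 w.2
    rw [this]
    exact hXo.preimage continuous_subtype_val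
  rw [funext pt_mk] at hU
  exact isOpen_coinduced.mpr hU

theorem pt_mem_interior_image {V : Set (ℝ × ℝ)} (hV : V ⊆ Chart.interior.dom)
    {w : ℝ × ℝ} (hw : w ∈ square) : pt w ∈ Chart.interior.param '' V ↔ w ∈ V := by
  have hs : ∀ z w : square, Glue z w → (z.1 ∈ V ↔ w.1 ∈ V) := by
    rintro ⟨z, hz⟩ ⟨w, hw⟩ ⟨k, ⟨h1, -, h2, -⟩ | ⟨h1, -, h2, -⟩⟩ <;> simp only at h1 h2 ⊢ <;>
      refine ⟨fun h => ?_, fun h => ?_⟩ <;> have := hV h <;>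
      simp only [Chart.dom, mem_prod, mem_Ioo] at this <;> linarith [this.1.1, this.1.2]
  constructor
  · rintro ⟨z, hz, h⟩
    exact (mem_iff_of_pt_eq hs (Or.inl (hV hz)) hw h).mp hz
  · exact fun h => ⟨w, h, rfl⟩

theorem Chart.param_vertical_of_le {k : ℕ} {z : ℝ × ℝ} (h : z.1 ≤ 1) :
    (Chart.vertical k).param z = pt z := if_pos h

theorem Chart.param_vertical_of_ge {k : ℕ} {z : ℝ × ℝ} (hz : z ∈ (Chart.vertical k).dom)
    (h : 1 ≤ z.1) : (Chart.vertical k).param z = pt (z.1 - 1, z.2 + shift k) := by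
  rcases h.eq_or_lt with h | h
  · have e : z = (1, z.2) := Prod.ext h.symm rfl
    rw [Chart.param_vertical_of_le h.symm.le, ← h, sub_self]
    conv_lhs => rw [e]
    exact pt_vertical hz.2 rfl
  · exact if_neg (not_le.mpr h)

theorem vertical_before_mem {k : ℕ} {z : ℝ × ℝ} (hz : z ∈ (Chart.vertical k).dom) (h : z.1 ≤ 1) :
    z ∈ square := by
  rcases h.eq_or_lt with h | h
  · exact Or.inr (Or.inl ⟨k, h, hz.2⟩)
  · exact Or.inl ⟨⟨hz.1.1, h⟩, far_bounds hz.2⟩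

theorem vertical_beyond_mem {k : ℕ} {z : ℝ × ℝ} (hz : z ∈ (Chart.vertical k).dom) (h : 1 ≤ z.1) :
    (z.1 - 1, z.2 + shift k) ∈ square := by
  have h2 := near_of_far hz.2
  rcases h.eq_or_lt with h | h
  · exact Or.inr (Or.inr (Or.inl ⟨k, by simp [← h], h2⟩))
  · exact Or.inl ⟨⟨by simp only; linarith, by simp only; linarith [hz.1.2]⟩, near_bounds h2⟩

/-- Computes the preimage in the square of a piece of an edge chart: the piece itself together with
its translate back from beyond the edge. Taking `V` open gives openness of the chart; taking `V` a
point gives injectivity and separates different charts. -/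
theorem pt_mem_vertical_image {k : ℕ} {V : Set (ℝ × ℝ)} (hV : V ⊆ (Chart.vertical k).dom)
    {w : ℝ × ℝ} (hw : w ∈ square) :
    pt w ∈ (Chart.vertical k).param '' V ↔ w ∈ V ∨ (w.1 + 1, w.2 - shift k) ∈ V := by
  set X : Set (ℝ × ℝ) := {w | w ∈ V ∨ (w.1 + 1, w.2 - shift k) ∈ V} with hXdef
  -- Invariance under gluing: the index of an edge interval is determined by a point of it, and
  -- points on horizontal edges have heights 0 and 1, which no vertical chart reaches.
  have hs : ∀ z w : square, Glue z w → (z.1 ∈ X ↔ w.1 ∈ X) := by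
    rintro ⟨⟨x, y⟩, hz⟩ ⟨⟨x', y'⟩, hw⟩ ⟨j, ⟨h1, h2, h3, h4⟩ | ⟨h1, h2, h3, h4⟩⟩ <;>
      simp only at h1 h2 h3 h4 <;> subst h1 h3 h4 <;> simp only [hXdef, mem_ofPred_eq]
    · constructor
      · rintro (h | h)
        · have := far_unique (hV h).2 h2
          subst this
          right
          simpa using h
        · have := (hV h).1.2
          norm_num at this
      · rintro (h | h)
        · have := (hV h).1.1
          norm_num at this
        · have h5 := (hV h).2
          simp only at h5
          rw [← near_iff_far, sub_add_cancel] at h5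
          have := near_unique h5 (near_of_far h2)
          subst this
          left
          simpa using h
    · have h5 := near_of_far h2
      refine iff_of_false ?_ ?_ <;> rintro (h | h) <;> have h6 := (hV h).2 <;> simp only at h6
      · linarith [far_bounds h6]
      · rw [← near_iff_far, sub_add_cancel] at h6
        linarith [near_bounds h6]
      · linarith [far_bounds h6]
      · rw [← near_iff_far, sub_add_cancel] at h6
        linarith [near_bounds h6]
  change _ ↔ w ∈ X
  constructor
  · rintro ⟨z, hz, h⟩
    rcases le_total z.1 1 with h1 | h1
    · rw [Chart.param_vertical_of_le h1] at h
      exact (mem_iff_of_pt_eq hs (vertical_before_mem (hV hz) h1) hw h).mp (Or.inl hz)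
    · rw [Chart.param_vertical_of_ge (hV hz) h1] at h
      exact (mem_iff_of_pt_eq hs (vertical_beyond_mem (hV hz) h1) hw h).mp (Or.inr (by simpa))
  · have hb := square_bounds hw
    rintro (h | h)
    · exact ⟨w, h, Chart.param_vertical_of_le hb.2.1⟩
    · refine ⟨_, h, ?_⟩
      rw [Chart.param_vertical_of_ge (hV h) (by simp only; linarith)]
      simp

/-- The reflection in the diagonal as a homeomorphism. -/
def flip : Surface ≃ₜ Surface where
  toFun := diagFlip
  invFun := diagFlip
  left_inv := diagFlip_diagFlip
  right_inv := diagFlip_diagFlip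
  continuous_toFun := continuous_diagFlip
  continuous_invFun := continuous_diagFlip

theorem swap_mem_vertical_dom {k : ℕ} {z : ℝ × ℝ} :
    z.swap ∈ (Chart.vertical k).dom ↔ z ∈ (Chart.horizontal k).dom := by
  simp only [Chart.dom, mem_prod, Prod.fst_swap, Prod.snd_swap, and_comm]

/-- The reflection in the diagonal exchanges the two families of edge charts, so only the vertical
ones need work. -/
theorem Chart.param_horizontal {k : ℕ} {z : ℝ × ℝ} (hz : z ∈ (Chart.horizontal k).dom) :
    (Chart.horizontal k).param z = diagFlip ((Chart.vertical k).param z.swap) := by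
  have hz' := swap_mem_vertical_dom.mpr hz
  rcases le_or_gt z.2 1 with h | h
  · rw [Chart.param_vertical_of_le (z := z.swap) h, diagFlip_pt (vertical_before_mem hz' h)]
    exact if_pos h
  · rw [Chart.param_vertical_of_ge hz' h.le, diagFlip_pt (vertical_beyond_mem hz' h.le)]
    exact if_neg (not_le.mpr h)

theorem Chart.image_horizontal {k : ℕ} {V : Set (ℝ × ℝ)} (hV : V ⊆ (Chart.horizontal k).dom) :
    (Chart.horizontal k).param '' V = flip '' ((Chart.vertical k).param '' (Prod.swap '' V)) := by
  rw [image_image, image_image]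
  exact image_congr fun z hz => Chart.param_horizontal (hV hz)

theorem Chart.isOpen_image (χ : Chart) {V : Set (ℝ × ℝ)} (hV : V ⊆ χ.dom) (ho : IsOpen V) :
    IsOpen (χ.param '' V) := by
  have key : ∀ (k : ℕ) {V : Set (ℝ × ℝ)} (_ : V ⊆ (Chart.vertical k).dom) (_ : IsOpen V),
      IsOpen ((Chart.vertical k).param '' V) := by
    intro k V hV ho
    refine isOpen_of_saturated (X := V ∪ (fun w : ℝ × ℝ => (w.1 + 1, w.2 - shift k)) ⁻¹' V)
      (ho.union (ho.preimage (by fun_prop))) fun w hw => pt_mem_vertical_image hV hw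
  cases χ with
  | interior => exact isOpen_of_saturated ho fun w hw => pt_mem_interior_image hV hw
  | vertical k => exact key k hV ho
  | horizontal k =>
    rw [Chart.image_horizontal hV]
    refine flip.isOpenMap _ (key k ?_ ?_)
    · rintro _ ⟨z, hz, rfl⟩
      exact swap_mem_vertical_dom.mpr (hV hz)
    · rw [image_swap_eq_preimage_swap]
      exact ho.preimage continuous_swap

theorem Chart.injOn_param (χ : Chart) : InjOn χ.param χ.dom := by
  have key : ∀ k, InjOn (Chart.vertical k).param (Chart.vertical k).dom := by
    intro k z hz z' hz' h
    have hV : {z} ⊆ (Chart.vertical k).dom := singleton_subset_iff.mpr hz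
    have h1 : (Chart.vertical k).param z' ∈ (Chart.vertical k).param '' {z} := by simp [h]
    have hy := hz.2
    have hy' := hz'.2
    rcases le_total z'.1 1 with h2 | h2
    · rw [Chart.param_vertical_of_le h2, pt_mem_vertical_image hV (vertical_before_mem hz' h2)]
        at h1
      rcases h1 with h1 | h1
      · exact h1.symm
      · rw [mem_singleton_iff] at h1
        rw [← h1] at hy
        simp only at hy
        rw [← near_iff_far, sub_add_cancel] at hy
        exact (far_disjoint_near hy' hy).elim
    · rw [Chart.param_vertical_of_ge hz' h2, pt_mem_vertical_image hV (vertical_beyond_mem hz' h2)]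
        at h1
      rcases h1 with h1 | h1
      · rw [mem_singleton_iff] at h1
        rw [← h1] at hy
        exact (far_disjoint_near hy (near_of_far hy')).elim
      · simpa using h1.symm
  cases χ with
  | interior =>
    intro z hz z' hz' h
    have := (pt_mem_interior_image (singleton_subset_iff.mpr hz) (Or.inl hz')).mp ⟨z, rfl, h⟩
    exact this.symm
  | vertical k => exact key k
  | horizontal k =>
    intro z hz z' hz' h
    rw [Chart.param_horizontal hz, Chart.param_horizontal hz'] at h
    exact Prod.swap_injective
      (key k (swap_mem_vertical_dom.mpr hz) (swap_mem_vertical_dom.mpr hz') (flip.injective h))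

theorem Chart.continuousOn_param (χ : Chart) : ContinuousOn χ.param χ.dom := by
  have key : ∀ k, ContinuousOn (Chart.vertical k).param (Chart.vertical k).dom := by
    intro k
    have hcl : IsClosed {z : ℝ × ℝ | z.1 ≤ 1} := isClosed_le continuous_fst continuous_const
    have hcl2 : closure {z : ℝ × ℝ | ¬ z.1 ≤ 1} ⊆ {z : ℝ × ℝ | 1 ≤ z.1} := by
      refine closure_minimal (fun z hz => ?_) (isClosed_le continuous_const continuous_fst)
      simp only [mem_ofPred_eq, not_le] at hz ⊢
      exact hz.le
    change ContinuousOn (fun z : ℝ × ℝ => if z.1 ≤ 1 then pt z else pt (z.1 - 1, z.2 + shift k)) _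
    refine ContinuousOn.if ?_ ?_ ?_
    · rintro z ⟨hz, hf⟩
      have h1 : z.1 = 1 := by
        have := frontier_le_subset_eq (continuous_fst (X := ℝ) (Y := ℝ)) continuous_const hf
        simpa using this
      rw [← Chart.param_vertical_of_le (k := k) h1.le, Chart.param_vertical_of_ge hz h1.ge]
    · refine continuousOn_pt.mono ?_
      rintro z ⟨hz, hz'⟩
      rw [hcl.closure_eq] at hz'
      exact vertical_before_mem hz hz'
    · refine continuousOn_pt.comp (by fun_prop) ?_
      rintro z ⟨hz, hz'⟩
      exact vertical_beyond_mem hz (hcl2 hz')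
  cases χ with
  | interior => exact continuousOn_pt.mono fun z hz => Or.inl hz
  | vertical k => exact key k
  | horizontal k =>
    refine (continuous_diagFlip.comp_continuousOn ((key k).comp continuous_swap.continuousOn
      fun z hz => swap_mem_vertical_dom.mpr hz)).congr fun z hz => ?_
    exact Chart.param_horizontal hz

theorem Chart.isOpen_carrier (χ : Chart) : IsOpen χ.carrier :=
  χ.isOpen_image Subset.rfl χ.isOpen_dom

theorem Chart.nonempty_dom (χ : Chart) : χ.dom.Nonempty := by
  have h : ∀ k, (farInterval k).Nonempty := fun k => by
    rw [farInterval, nonempty_Ioo, pow_succ]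
    linarith [pow_half_pos k]
  cases χ with
  | interior => exact ⟨(1 / 2, 1 / 2), by norm_num [Chart.dom]⟩
  | vertical k =>
    obtain ⟨y, hy⟩ := h k
    exact ⟨(1, y), by norm_num, hy⟩
  | horizontal k =>
    obtain ⟨y, hy⟩ := h k
    exact ⟨(y, 1), hy, by norm_num⟩

/-- The parametrization of the carrier of a chart, as a homeomorphism onto an open set. -/
def Chart.homeo (χ : Chart) : OpenPartialHomeomorph (ℝ × ℝ) Surface :=
  haveI : Nonempty (ℝ × ℝ) := ⟨0⟩
  OpenPartialHomeomorph.ofContinuousOpenRestrict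
    (χ.injOn_param.toPartialEquiv χ.param χ.dom) χ.continuousOn_param
    (by
      refine fun U hU => ?_
      have h : χ.dom.domRestrict χ.param '' U = χ.param '' (Subtype.val '' U) := by
        rw [image_image]; rfl
      refine (congrArg IsOpen h).mpr ?_
      exact χ.isOpen_image (by rintro _ ⟨x, -, rfl⟩; exact x.2)
        (χ.isOpen_dom.isOpenMap_subtype_val _ hU)) χ.isOpen_dom

theorem Chart.homeo_apply (χ : Chart) (z : ℝ × ℝ) : χ.homeo z = χ.param z := rfl

theorem Chart.param_mem {χ : Chart} {z : ℝ × ℝ} (hz : z ∈ χ.dom) : χ.param z ∈ χ.carrier :=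
  ⟨z, hz, rfl⟩

theorem Chart.param_before {χ : Chart} {z : ℝ × ℝ} (hz : z ∈ χ.dom) (h : χ.Before z) :
    z ∈ Chart.interior.dom ∧ χ.param z = pt z := by
  cases χ with
  | interior => exact ⟨hz, rfl⟩
  | vertical k => exact ⟨⟨⟨hz.1.1, h⟩, far_bounds hz.2⟩, if_pos h.le⟩
  | horizontal k => exact ⟨⟨far_bounds hz.1, ⟨hz.2.1, h⟩⟩, if_pos h.le⟩

/-- The translation that carries the part of an edge chart beyond the edge into the square. -/
def Chart.back : Chart → ℝ × ℝ → ℝ × ℝ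
  | interior, z => z
  | vertical k, z => (z.1 - 1, z.2 + shift k)
  | horizontal k, z => (z.1 + shift k, z.2 - 1)

theorem Chart.param_beyond {χ : Chart} {z : ℝ × ℝ} (hz : z ∈ χ.dom) (h : χ.Beyond z) :
    χ.back z ∈ Chart.interior.dom ∧ χ.param z = pt (χ.back z) := by
  cases χ with
  | interior => exact h.elim
  | vertical k =>
    exact ⟨⟨⟨sub_pos.mpr h, by simp only [Chart.back]; linarith [hz.1.2]⟩,
      near_bounds (near_of_far hz.2)⟩, if_neg (not_le.mpr h)⟩
  | horizontal k =>
    exact ⟨⟨near_bounds (near_of_far hz.1),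
      ⟨sub_pos.mpr h, by simp only [Chart.back]; linarith [hz.2.2]⟩⟩, if_neg (not_le.mpr h)⟩

theorem pt_mem_interior_iff {w : ℝ × ℝ} (hw : w ∈ square) :
    pt w ∈ Chart.interior.carrier ↔ w ∈ Chart.interior.dom :=
  pt_mem_interior_image Subset.rfl hw

/-- A point of a chart lies in the open square unless it is on the edge. -/
theorem Chart.param_mem_interior_iff {χ : Chart} {z : ℝ × ℝ} (hz : z ∈ χ.dom) :
    χ.param z ∈ Chart.interior.carrier ↔ χ.Before z ∨ χ.Beyond z := by
  constructor
  · intro h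
    cases χ with
    | interior => exact Or.inl trivial
    | vertical k =>
      rcases lt_trichotomy z.1 1 with h1 | h1 | h1
      · exact Or.inl h1
      · rw [Chart.param_vertical_of_le h1.le,
          pt_mem_interior_iff (vertical_before_mem hz h1.le)] at h
        exact (h.1.2.ne h1).elim
      · exact Or.inr h1
    | horizontal k =>
      rcases lt_trichotomy z.2 1 with h1 | h1 | h1
      · exact Or.inl h1
      · have hz' := swap_mem_vertical_dom.mpr hz
        have hsq := swap_mem (vertical_before_mem hz' (by exact h1.le))
        rw [Prod.swap_swap] at hsq
        have e : (Chart.horizontal k).param z = pt z := if_pos h1.le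
        rw [e, pt_mem_interior_iff hsq] at h
        exact (h.2.2.ne h1).elim
      · exact Or.inr h1
  · rintro (h | h)
    · have := Chart.param_before hz h
      exact ⟨z, this.1, this.2.symm⟩
    · have := Chart.param_beyond hz h
      exact ⟨_, this.1, this.2.symm⟩

theorem Chart.exists_mem (s : Surface) : ∃ χ : Chart, s ∈ χ.carrier := by
  obtain ⟨z, hz, rfl⟩ := exists_pt s
  rcases id hz with h | ⟨k, hx, hy⟩ | ⟨k, hx, hy⟩ | ⟨k, hy, hx⟩ | ⟨k, hy, hx⟩
  · exact ⟨.interior, z, h, rfl⟩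
  · exact ⟨.vertical k, z, ⟨by norm_num [hx], hy⟩, if_pos hx.le⟩
  · refine ⟨.vertical k, ?_⟩
    have h : (1, z.2 - shift k) ∈ (Chart.vertical k).dom :=
      ⟨by norm_num, by simp only; rw [← near_iff_far, sub_add_cancel]; exact hy⟩
    refine ⟨_, h, ?_⟩
    rw [Chart.param_vertical_of_ge h le_rfl]
    simp [← hx]
  · exact ⟨.horizontal k, z, ⟨hx, by norm_num [hy]⟩, if_pos hy.le⟩
  · refine ⟨.horizontal k, ?_⟩
    have h : (1, z.1 - shift k) ∈ (Chart.vertical k).dom :=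
      ⟨by norm_num, by simp only; rw [← near_iff_far, sub_add_cancel]; exact hx⟩
    refine ⟨(z.1 - shift k, 1), swap_mem_vertical_dom.mp h, ?_⟩
    rw [Chart.param_horizontal (swap_mem_vertical_dom.mp h)]
    simp only [Prod.swap]
    rw [Chart.param_vertical_of_ge h le_rfl, diagFlip_pt (vertical_beyond_mem h le_rfl)]
    simp [← hy]

/-- Distinct charts meet only inside the open square. Both the choice of reference paths to edge
points and the continuity of the bundle transition functions depend on this. -/
theorem Chart.eq_of_mem_of_notMem_interior {χ χ' : Chart} {s : Surface} (h : s ∈ χ.carrier)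
    (h' : s ∈ χ'.carrier) (hs : s ∉ Chart.interior.carrier) : χ = χ' := by
  have key : ∀ {k} {z : ℝ × ℝ}, z ∈ (Chart.vertical k).dom → (Chart.vertical k).param z = s →
      z.1 = 1 ∧ s = pt z ∧ z ∈ square := by
    intro k z hz hzs
    rw [← hzs, Chart.param_mem_interior_iff hz, not_or] at hs
    have h1 : z.1 = 1 := le_antisymm (not_lt.mp hs.2) (not_lt.mp hs.1)
    exact ⟨h1, by rw [← hzs, Chart.param_vertical_of_le h1.le], vertical_before_mem hz h1.le⟩
  have key' : ∀ {k} {z : ℝ × ℝ}, z ∈ (Chart.horizontal k).dom → (Chart.horizontal k).param z = s →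
      z.2 = 1 ∧ s = pt z ∧ z ∈ square := by
    intro k z hz hzs
    rw [← hzs, Chart.param_mem_interior_iff hz, not_or] at hs
    have h1 : z.2 = 1 := le_antisymm (not_lt.mp hs.2) (not_lt.mp hs.1)
    refine ⟨h1, by rw [← hzs]; exact if_pos h1.le, ?_⟩
    have := swap_mem (vertical_before_mem (swap_mem_vertical_dom.mpr hz) (by exact h1.le))
    rwa [Prod.swap_swap] at this
  have mixed : ∀ {k j} {z w : ℝ × ℝ}, z ∈ (Chart.vertical k).dom →
      (Chart.vertical k).param z = s → w ∈ (Chart.horizontal j).dom →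
      (Chart.horizontal j).param w = s → False := by
    intro k j z w hz hzs hw hws
    obtain ⟨h1, h2, h3⟩ := key hz hzs
    obtain ⟨h1', h2', h3'⟩ := key' hw hws
    have hm : pt w ∈ (Chart.vertical k).param '' {z} := by simp [hzs, h2']
    rw [pt_mem_vertical_image (singleton_subset_iff.mpr hz) h3'] at hm
    have hw1 := far_bounds hw.1
    rcases hm with hm | hm <;> rw [mem_singleton_iff] at hm <;> rw [← hm] at h1
    · linarith
    · simp only at h1; linarith
  obtain ⟨z, hz, hzs⟩ := h
  obtain ⟨w, hw, hws⟩ := h'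
  cases χ with
  | interior => exact (hs ⟨z, hz, hzs⟩).elim
  | vertical k =>
    cases χ' with
    | interior => exact (hs ⟨w, hw, hws⟩).elim
    | vertical j =>
      obtain ⟨h1, h2, h3⟩ := key hz hzs
      obtain ⟨h1', h2', h3'⟩ := key hw hws
      have hm : pt w ∈ (Chart.vertical k).param '' {z} := by simp [hzs, h2']
      rw [pt_mem_vertical_image (singleton_subset_iff.mpr hz) h3'] at hm
      rcases hm with hm | hm <;> rw [mem_singleton_iff] at hm
      · rw [← hm] at hz
        rw [far_unique hz.2 hw.2]
      · rw [← hm] at h1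
        simp only at h1
        linarith
    | horizontal j => exact (mixed hz hzs hw hws).elim
  | horizontal k =>
    cases χ' with
    | interior => exact (hs ⟨w, hw, hws⟩).elim
    | vertical j => exact (mixed hw hws hz hzs).elim
    | horizontal j =>
      obtain ⟨h1, h2, h3⟩ := key' hz hzs
      obtain ⟨h1', h2', h3'⟩ := key' hw hws
      have hz' := swap_mem_vertical_dom.mpr hz
      have hw' := swap_mem_vertical_dom.mpr hw
      have hm : pt w.swap ∈ (Chart.vertical k).param '' {z.swap} := by
        rw [image_singleton, mem_singleton_iff, Chart.param_vertical_of_le (by exact h1.le),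
          ← diagFlip_pt h3, ← diagFlip_pt h3', ← h2, ← h2']
      rw [pt_mem_vertical_image (singleton_subset_iff.mpr hz') (swap_mem h3')] at hm
      rcases hm with hm | hm <;> rw [mem_singleton_iff] at hm
      · have := Prod.swap_injective hm
        rw [← this] at hz
        rw [far_unique hz.1 hw.1]
      · have := congrArg Prod.fst hm
        simp only [Prod.fst_swap] at this
        linarith

/-! ### Loops determined by paths -/

theorem Chart.simplyConnected_carrier (χ : Chart) : SimplyConnectedSpace χ.carrier := by
  have : ContractibleSpace χ.dom := χ.convex_dom.contractibleSpace χ.nonempty_dom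
  let e : χ.dom ≃ₜ χ.carrier := χ.homeo.toHomeomorphSourceTarget
  have : ContractibleSpace χ.carrier := e.symm.contractibleSpace
  infer_instance

theorem Chart.homotopic {χ : Chart} {x y : Surface} (c c' : Path x y)
    (h : ∀ t, c t ∈ χ.carrier) (h' : ∀ t, c' t ∈ χ.carrier) : c.Homotopic c' := by
  have := χ.simplyConnected_carrier
  have hx : x ∈ χ.carrier := by simpa using h 0
  have hy : y ∈ χ.carrier := by simpa using h 1
  let lift : ∀ c : Path x y, (∀ t, c t ∈ χ.carrier) →
      Path (⟨x, hx⟩ : χ.carrier) ⟨y, hy⟩ := fun c h =>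
    { toFun := fun t => ⟨c t, h t⟩
      continuous_toFun := by fun_prop
      source' := by simp
      target' := by simp }
  have := (SimplyConnectedSpace.paths_homotopic (lift c h) (lift c' h')).map
    ⟨Subtype.val, continuous_subtype_val⟩
  exact this

theorem Chart.joinedIn {χ : Chart} {s s' : Surface} (h : s ∈ χ.carrier) (h' : s' ∈ χ.carrier) :
    JoinedIn χ.carrier s s' := by
  have := χ.simplyConnected_carrier
  exact (isPathConnected_iff_pathConnectedSpace.mpr inferInstance).joinedIn s h s' h'

/-- The midpoint of `farInterval k`. -/
def farMid (k : ℕ) : ℝ := 1 - 3 / 4 * (1 / 2) ^ k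

theorem farMid_mem (k : ℕ) : farMid k ∈ farInterval k := by
  have := pow_half_pos k
  simp only [farInterval, farMid, mem_Ioo, pow_succ]
  constructor <;> linarith

/-- A reference point of the domain of a chart before the edge. -/
def Chart.pre : Chart → ℝ × ℝ
  | interior => (1 / 8, 1 / 8)
  | vertical k => (7 / 8, farMid k)
  | horizontal k => (farMid k, 7 / 8)

/-- A reference point of the domain of an edge chart beyond the edge. -/
def Chart.post : Chart → ℝ × ℝ
  | interior => (1 / 8, 1 / 8)
  | vertical k => (9 / 8, farMid k)
  | horizontal k => (farMid k, 9 / 8)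

theorem Chart.pre_mem (χ : Chart) : χ.pre ∈ χ.dom := by
  cases χ with
  | interior => norm_num [Chart.pre, Chart.dom]
  | vertical k => exact ⟨by norm_num [Chart.pre], farMid_mem k⟩
  | horizontal k => exact ⟨farMid_mem k, by norm_num [Chart.pre]⟩

theorem Chart.post_mem (χ : Chart) : χ.post ∈ χ.dom := by
  cases χ with
  | interior => norm_num [Chart.post, Chart.dom]
  | vertical k => exact ⟨by norm_num [Chart.post], farMid_mem k⟩
  | horizontal k => exact ⟨farMid_mem k, by norm_num [Chart.post]⟩

theorem Chart.before_pre (χ : Chart) : χ.Before χ.pre := by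
  cases χ <;> norm_num [Chart.pre, Chart.Before]

theorem Chart.pre_mem_interior (χ : Chart) : χ.param χ.pre ∈ Chart.interior.carrier :=
  (Chart.param_mem_interior_iff χ.pre_mem).mpr (Or.inl χ.before_pre)

theorem Chart.post_mem_interior (χ : Chart) : χ.param χ.post ∈ Chart.interior.carrier := by
  rw [Chart.param_mem_interior_iff χ.post_mem]
  cases χ <;> norm_num [Chart.post, Chart.Before, Chart.Beyond]

theorem basepoint_mem_interior : basepoint ∈ Chart.interior.carrier :=
  Chart.pre_mem_interior .interior

open Classical in
/-- A reference path from the basepoint to a point: inside the open square as long as possible. -/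
def toPoint (s : Surface) : Path basepoint s :=
  if h : s ∈ Chart.interior.carrier then (Chart.joinedIn basepoint_mem_interior h).somePath
  -- An edge point is approached from the side before the edge, inside the only chart containing it;
  -- edge points thus count as not yet crossed.
  else (Chart.joinedIn basepoint_mem_interior
      (Chart.pre_mem_interior (Chart.exists_mem s).choose)).somePath.trans
    (Chart.joinedIn (Chart.param_mem (Chart.pre_mem _)) (Chart.exists_mem s).choose_spec).somePath

theorem toPoint_mem {s : Surface} (h : s ∈ Chart.interior.carrier) (t : unitInterval) :
    toPoint s t ∈ Chart.interior.carrier := by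
  rw [toPoint, dif_pos h]
  exact JoinedIn.somePath_mem _ _

open CategoryTheory

/-- The loop at the basepoint obtained by closing a path by means of the reference paths. -/
def loop {x y : Surface} (c : Path x y) : Pi1 :=
  FundamentalGroup.fromPath
    (Path.Homotopic.Quotient.mk ((toPoint x).trans (c.trans (toPoint y).symm)))

theorem loop_eq {x y : Surface} (c : Path x y) :
    loop c = (show FundamentalGroupoid.mk basepoint ⟶ FundamentalGroupoid.mk x from
        Path.Homotopic.Quotient.mk (toPoint x)) ≫
      (show FundamentalGroupoid.mk x ⟶ FundamentalGroupoid.mk y from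
        Path.Homotopic.Quotient.mk c) ≫
      Groupoid.inv (show FundamentalGroupoid.mk basepoint ⟶ FundamentalGroupoid.mk y from
        Path.Homotopic.Quotient.mk (toPoint y)) := rfl

/-- The reference path to `y` and its inverse cancel. Multiplication in `Pi1` puts the later path on
the left. -/
theorem loop_trans {x y z : Surface} (c : Path x y) (c' : Path y z) :
    loop (c.trans c') = loop c' * loop c := by
  have : (show FundamentalGroupoid.mk x ⟶ FundamentalGroupoid.mk z from
        Path.Homotopic.Quotient.mk (c.trans c')) =
      (show FundamentalGroupoid.mk x ⟶ FundamentalGroupoid.mk y from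
        Path.Homotopic.Quotient.mk c) ≫
      (show FundamentalGroupoid.mk y ⟶ FundamentalGroupoid.mk z from
        Path.Homotopic.Quotient.mk c') := rfl
  have key : ∀ {C : Type} [Groupoid C] {A X Y Z : C} (a : A ⟶ X) (b : X ⟶ Y) (d : A ⟶ Y)
      (e : Y ⟶ Z) (f : Z ⟶ A), a ≫ (b ≫ e) ≫ f = (a ≫ b ≫ Groupoid.inv d) ≫ d ≫ e ≫ f := by
    intros
    simp
  rw [loop_eq, this, End.mul_def, loop_eq, loop_eq]
  exact key _ _ _ _ _

theorem loop_congr {x y : Surface} {c c' : Path x y} (h : c.Homotopic c') : loop c = loop c' := by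
  rw [loop_eq, loop_eq, Path.Homotopic.Quotient.eq.mpr h]

theorem loop_refl (x : Surface) : loop (Path.refl x) = 1 := by
  have h : loop ((Path.refl x).trans (Path.refl x)) = loop (Path.refl x) :=
    loop_congr ⟨Path.Homotopy.reflTrans _⟩
  rw [loop_trans] at h
  exact mul_eq_left.mp h

theorem loop_symm {x y : Surface} (c : Path x y) : loop c.symm = (loop c)⁻¹ := by
  rw [eq_inv_iff_mul_eq_one, ← loop_trans, ← loop_refl x]
  exact loop_congr ⟨(Path.Homotopy.reflTransSymm c).symm⟩

theorem loop_cast {x y x' y' : Surface} (c : Path x y) (hx : x' = x) (hy : y' = y) :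
    loop (c.cast hx hy) = loop c := by
  subst hx hy
  rfl

theorem loop_of_interior {x y : Surface} (c : Path x y)
    (h : ∀ t, c t ∈ Chart.interior.carrier) : loop c = 1 := by
  have hx : x ∈ Chart.interior.carrier := by simpa using h 0
  have hy : y ∈ Chart.interior.carrier := by simpa using h 1
  have h1 : ((toPoint x).trans c).Homotopic (toPoint y) := by
    refine Chart.homotopic _ _ (fun t => ?_) (toPoint_mem hy)
    rw [Path.trans_apply]
    split_ifs
    · exact toPoint_mem hx _
    · exact h _
  rw [loop_eq, ← Category.assoc]
  have : (show FundamentalGroupoid.mk basepoint ⟶ FundamentalGroupoid.mk x from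
        Path.Homotopic.Quotient.mk (toPoint x)) ≫
      (show FundamentalGroupoid.mk x ⟶ FundamentalGroupoid.mk y from
        Path.Homotopic.Quotient.mk c) = Path.Homotopic.Quotient.mk (toPoint y) :=
    Path.Homotopic.Quotient.eq.mpr h1
  rw [this]
  exact Groupoid.comp_inv _

theorem loop_basepoint (c : Path basepoint basepoint) :
    loop c = FundamentalGroup.fromPath (Path.Homotopic.Quotient.mk c) := by
  have h1 : Path.Homotopic.Quotient.mk (toPoint basepoint) =
      Path.Homotopic.Quotient.mk (Path.refl basepoint) :=
    Path.Homotopic.Quotient.eq.mpr (Chart.homotopic _ _ (toPoint_mem basepoint_mem_interior)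
      fun _ => basepoint_mem_interior)
  have key : ∀ {C : Type} [Groupoid C] {A : C} (a b : A ⟶ A), a = 𝟙 A →
      a ≫ b ≫ Groupoid.inv a = b := by
    rintro C _ A a b rfl
    simp
  rw [loop_eq]
  exact key _ _ h1

theorem loop_toPoint {s : Surface} : loop (toPoint s) = 1 := by
  have h1 : Path.Homotopic.Quotient.mk (toPoint basepoint) =
      Path.Homotopic.Quotient.mk (Path.refl basepoint) :=
    Path.Homotopic.Quotient.eq.mpr (Chart.homotopic _ _ (toPoint_mem basepoint_mem_interior)
      fun _ => basepoint_mem_interior)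
  rw [loop_eq, h1]
  exact (Category.id_comp _).trans (Groupoid.comp_inv _)

/-- The generator of the fundamental group that crosses the edge of an edge chart. -/
def gen (χ : Chart) : Pi1 :=
  loop (Chart.joinedIn (Chart.param_mem χ.pre_mem) (Chart.param_mem χ.post_mem)).somePath

theorem gen_interior : gen .interior = 1 :=
  loop_of_interior _ fun _ => JoinedIn.somePath_mem _ _

open Classical in
/-- The locally constant function on a chart off the edge with value `1` before the edge, and `w`
beyond the edge. -/
def Chart.jump {K : Type*} [Group K] (w : Chart → K) (χ : Chart) (z : ℝ × ℝ) : K :=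
  if χ.Beyond z then w χ else 1

theorem Chart.convex_before (χ : Chart) : Convex ℝ {z | z ∈ χ.dom ∧ χ.Before z} := by
  refine χ.convex_dom.inter (s := χ.dom) (t := {z | χ.Before z}) ?_
  cases χ with
  | interior => exact convex_univ
  | vertical k => exact convex_halfSpace_lt (LinearMap.fst ℝ ℝ ℝ).isLinear 1
  | horizontal k => exact convex_halfSpace_lt (LinearMap.snd ℝ ℝ ℝ).isLinear 1

theorem Chart.convex_beyond (χ : Chart) : Convex ℝ {z | z ∈ χ.dom ∧ χ.Beyond z} := by
  refine χ.convex_dom.inter (s := χ.dom) (t := {z | χ.Beyond z}) ?_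
  cases χ with
  | interior => exact convex_empty
  | vertical k => exact convex_halfSpace_gt (LinearMap.fst ℝ ℝ ℝ).isLinear 1
  | horizontal k => exact convex_halfSpace_gt (LinearMap.snd ℝ ℝ ℝ).isLinear 1

theorem Chart.exists_path_of_convex {χ : Chart} {C : Set (ℝ × ℝ)} (hC : Convex ℝ C)
    (hCd : C ⊆ χ.dom) {z z' : ℝ × ℝ} (hz : z ∈ C) (hz' : z' ∈ C) :
    ∃ c : Path (χ.param z) (χ.param z'), ∀ t, c t ∈ χ.param '' C := by
  have h := (hC.isPathConnected ⟨z, hz⟩).image' (χ.continuousOn_param.mono hCd)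
  have := h.joinedIn _ ⟨z, hz, rfl⟩ _ ⟨z', hz', rfl⟩
  exact ⟨this.somePath, this.somePath_mem⟩

/-- Paths in a chart with common endpoints are homotopic, so `c` may be replaced: by a path inside
the square if `z` is before the edge, by one through `post` if `z` is beyond it. -/
theorem loop_of_pre {χ : Chart} {z : ℝ × ℝ} (hz : z ∈ χ.dom)
    (c : Path (χ.param χ.pre) (χ.param z)) (hc : ∀ t, c t ∈ χ.carrier) :
    loop c = χ.jump gen z := by
  by_cases hb : χ.Beyond z
  · rw [Chart.jump, if_pos hb]
    have hp : χ.Beyond χ.post := by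
      cases χ
      · exact hb.elim
      · norm_num [Chart.Beyond, Chart.post]
      · norm_num [Chart.Beyond, Chart.post]
    obtain ⟨c', hc'⟩ := Chart.exists_path_of_convex χ.convex_beyond (fun z h => h.1)
      ⟨χ.post_mem, hp⟩ ⟨hz, hb⟩
    have h1 : loop c' = 1 := by
      refine loop_of_interior _ fun t => ?_
      obtain ⟨w, hw, h⟩ := hc' t
      rw [← h, Chart.param_mem_interior_iff hw.1]
      exact Or.inr hw.2
    have h2 : loop c = loop ((Chart.joinedIn (Chart.param_mem χ.pre_mem)
        (Chart.param_mem χ.post_mem)).somePath.trans c') := by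
      refine loop_congr (Chart.homotopic _ _ hc fun t => ?_)
      rw [Path.trans_apply]
      split_ifs
      · exact JoinedIn.somePath_mem _ _
      · exact image_mono (fun z h => h.1) (hc' _)
    rw [h2, loop_trans, h1, one_mul]
    rfl
  · rw [Chart.jump, if_neg hb]
    by_cases hb' : χ.Before z
    · obtain ⟨c', hc'⟩ := Chart.exists_path_of_convex χ.convex_before (fun z h => h.1)
        ⟨χ.pre_mem, χ.before_pre⟩ ⟨hz, hb'⟩
      have h2 : loop c = loop c' :=
        loop_congr (Chart.homotopic _ _ hc fun t => image_mono (fun z h => h.1) (hc' t))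
      rw [h2]
      refine loop_of_interior _ fun t => ?_
      obtain ⟨w, hw, h⟩ := hc' t
      rw [← h, Chart.param_mem_interior_iff hw.1]
      exact Or.inl hw.2
    -- On the edge, the chart chosen by `toPoint` must be `χ`, so `c` is homotopic to the last piece
    -- of the reference path, whose loop is trivial by `loop_toPoint`.
    · have hs : χ.param z ∉ Chart.interior.carrier := by
        rw [Chart.param_mem_interior_iff hz, not_or]
        exact ⟨hb', hb⟩
      have hχ : (Chart.exists_mem (χ.param z)).choose = χ :=
        Chart.eq_of_mem_of_notMem_interior (Chart.exists_mem (χ.param z)).choose_spec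
          (Chart.param_mem hz) hs
      have h1 := loop_toPoint (s := χ.param z)
      rw [toPoint, dif_neg hs, loop_trans, loop_of_interior _ fun _ => JoinedIn.somePath_mem _ _,
        mul_one] at h1
      rw [← h1]
      generalize_proofs p1 p2 p3 p4 at h1 ⊢
      have hj : ∀ (χ' : Chart) (h' : χ' = χ) (J : JoinedIn χ'.carrier (χ'.param χ'.pre)
          (χ.param z)), loop c = loop J.somePath := by
        rintro χ' rfl J
        exact loop_congr (Chart.homotopic _ _ hc J.somePath_mem)
      exact hj _ hχ _

/-- The loop of a path inside a chart depends on the positions of its endpoints relative to the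
edge. -/
theorem loop_of_chart {χ : Chart} {x y : Surface} {z z' : ℝ × ℝ} (hz : z ∈ χ.dom)
    (hz' : z' ∈ χ.dom) (c : Path x y) (hx : χ.param z = x) (hy : χ.param z' = y)
    (hc : ∀ t, c t ∈ χ.carrier) : loop c = χ.jump gen z' * (χ.jump gen z)⁻¹ := by
  subst hx hy
  have J := Chart.joinedIn (Chart.param_mem χ.pre_mem) (Chart.param_mem hz)
  rw [← loop_of_pre hz J.somePath J.somePath_mem, eq_mul_inv_iff_mul_eq, ← loop_trans]
  refine loop_of_pre hz' _ fun t => ?_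
  rw [Path.trans_apply]
  split_ifs
  · exact J.somePath_mem _
  · exact hc _

/-- Compactness of the interval: subdivide the path into pieces that each lie in one chart and
multiply their loops. -/
theorem loop_mem_of_chart (N : Subgroup Pi1)
    (hN : ∀ (χ : Chart) (x y : Surface) (c : Path x y), (∀ t, c t ∈ χ.carrier) → loop c ∈ N)
    {x y : Surface} (c : Path x y) : loop c ∈ N := by
  obtain ⟨t, h0, hmono, ⟨n, hn⟩, ht⟩ := exists_monotone_Icc_subset_open_cover_unitInterval
    (c := fun χ : Chart => c ⁻¹' χ.carrier) (fun χ => χ.isOpen_carrier.preimage c.continuous)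
    (fun t _ => mem_iUnion.mpr (Chart.exists_mem (c t)))
  have key : ∀ m, loop (c.subpath (t 0) (t m)) ∈ N := by
    intro m
    induction m with
    | zero =>
      rw [Path.subpath_self, loop_refl]
      exact N.one_mem
    | succ m ih =>
      rw [← loop_congr ⟨Path.Homotopy.subpathTransSubpath c (t 0) (t m) (t (m + 1))⟩, loop_trans]
      refine N.mul_mem ?_ ih
      obtain ⟨χ, hχ⟩ := ht m
      refine hN χ _ _ _ fun s => ?_
      have : c.subpath (t m) (t (m + 1)) s ∈ c '' Icc (t m) (t (m + 1)) := by
        rw [← Path.range_subpath_of_le _ _ _ (hmono m.le_succ)]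
        exact mem_range_self s
      obtain ⟨r, hr, h⟩ := this
      rw [← h]
      exact hχ hr
  have h1 := key n
  rw [hn n le_rfl, h0, Path.subpath_zero_one, loop_cast] at h1
  exact h1

theorem closure_gen : Subgroup.closure (range gen) = ⊤ := by
  rw [eq_top_iff]
  intro γ _
  obtain ⟨c, rfl⟩ := Path.Homotopic.Quotient.mk_surjective γ
  rw [show Path.Homotopic.Quotient.mk c = loop c from (loop_basepoint c).symm]
  refine loop_mem_of_chart _ (fun χ x y c hc => ?_) c
  obtain ⟨z, hz, hx⟩ : x ∈ χ.carrier := by simpa using hc 0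
  obtain ⟨z', hz', hy⟩ : y ∈ χ.carrier := by simpa using hc 1
  have hj : ∀ z, χ.jump gen z ∈ Subgroup.closure (range gen) := by
    intro z
    rw [Chart.jump]
    split_ifs
    · exact Subgroup.subset_closure (mem_range_self χ)
    · exact Subgroup.one_mem _
  rw [loop_of_chart hz hz' c hx hy hc]
  exact Subgroup.mul_mem _ (hj z') (Subgroup.inv_mem _ (hj z))

theorem hom_ext {K : Type*} [Group K] {f g : Pi1 →* K} (h : ∀ χ, f (gen χ) = g (gen χ)) :
    f = g := by
  refine MonoidHom.eq_of_eqOn_dense closure_gen ?_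
  rintro _ ⟨χ, rfl⟩
  exact h χ

/-! ### Covers with prescribed monodromy -/

section CoverConstruction

variable {d : ℕ} (w : Chart → Equiv.Perm (Fin d))

/-- The jump function of a chart as a function on the surface. -/
def jumpAt (χ : Chart) (s : Surface) : Equiv.Perm (Fin d) := χ.jump w (χ.homeo.symm s)

theorem jumpAt_param {χ : Chart} {z : ℝ × ℝ} (hz : z ∈ χ.dom) :
    jumpAt w χ (χ.param z) = χ.jump w z := by
  rw [jumpAt, ← Chart.homeo_apply, χ.homeo.left_inv hz]

theorem jumpAt_interior (s : Surface) : jumpAt w .interior s = 1 := if_neg id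

theorem Chart.isOpen_beyond (χ : Chart) : IsOpen {z | χ.Beyond z} := by
  cases χ with
  | interior => exact isOpen_empty
  | vertical k => exact isOpen_lt continuous_const continuous_fst
  | horizontal k => exact isOpen_lt continuous_const continuous_snd

theorem Chart.isOpen_before (χ : Chart) : IsOpen {z | χ.Before z} := by
  cases χ with
  | interior => exact isOpen_univ
  | vertical k => exact isOpen_lt continuous_fst continuous_const
  | horizontal k => exact isOpen_lt continuous_snd continuous_const

theorem Chart.not_beyond_of_before {χ : Chart} {z : ℝ × ℝ} (h : χ.Before z) : ¬ χ.Beyond z := by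
  cases χ with
  | interior => exact id
  | vertical k => exact not_lt.mpr (le_of_lt h)
  | horizontal k => exact not_lt.mpr (le_of_lt h)

theorem eventually_jumpAt {χ : Chart} {s : Surface} (hs : s ∈ χ.carrier)
    (hi : s ∈ Chart.interior.carrier) : ∀ᶠ s' in 𝓝 s, jumpAt w χ s' = jumpAt w χ s := by
  have hc := χ.homeo.symm.continuousAt (x := s) hs
  obtain ⟨z, hz, rfl⟩ := hs
  have hz' : χ.homeo.symm (χ.param z) = z := χ.homeo.left_inv hz
  rw [ContinuousAt, hz'] at hc
  rcases (Chart.param_mem_interior_iff hz).mp hi with h | h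
  · filter_upwards [hc (χ.isOpen_before.mem_nhds h)] with s' hs'
    rw [jumpAt, Chart.jump, if_neg (Chart.not_beyond_of_before hs'), jumpAt_param w hz, Chart.jump,
      if_neg (Chart.not_beyond_of_before h)]
  · filter_upwards [hc (χ.isOpen_beyond.mem_nhds h)] with s' hs'
    rw [jumpAt, Chart.jump, if_pos (by exact hs'), jumpAt_param w hz, Chart.jump, if_pos h]

/-- The fiber bundle with discrete fibers whose monodromy across the edges is given by `w`. -/
def coverCore : FiberBundleCore Chart Surface (Fin d) where
  baseSet := Chart.carrier
  isOpen_baseSet := Chart.isOpen_carrier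
  indexAt s := (Chart.exists_mem s).choose
  mem_baseSet_at s := (Chart.exists_mem s).choose_spec
  -- As a quotient of jumps, the coordinate change satisfies the cocycle identities by cancellation.
  -- Only continuity has content: inside the open square the jumps are locally constant, and at an
  -- edge point both charts coincide.
  coordChange χ χ' s v := ((jumpAt w χ' s)⁻¹ * jumpAt w χ s) v
  coordChange_self χ s _ v := by simp
  coordChange_comp χ χ' χ'' s _ v := by simp
  continuousOn_coordChange χ χ' := by
    rintro ⟨s, v⟩ ⟨⟨h, h'⟩, -⟩
    refine ContinuousAt.continuousWithinAt ?_
    by_cases hi : s ∈ Chart.interior.carrier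
    · have h2 : ContinuousAt (fun p : Surface × Fin d =>
          ((jumpAt w χ' s)⁻¹ * jumpAt w χ s) p.2) (s, v) :=
        continuous_of_discreteTopology.continuousAt.comp continuousAt_snd
      refine h2.congr ?_
      have := (eventually_jumpAt w h hi).and (eventually_jumpAt w h' hi)
      filter_upwards [continuousAt_fst.eventually this] with p hp
      rw [hp.1, hp.2]
    · have := Chart.eq_of_mem_of_notMem_interior h h' hi
      subst this
      simpa using continuousAt_snd

/-- The total space of the bundle with monodromy across the edges given by `w`. -/
abbrev CoverSpace : Type := (coverCore w).TotalSpace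

theorem isCoveringMap_cover : IsCoveringMap ((coverCore w).proj) :=
  FiberBundle.isCoveringMap (F := Fin d) (E := (coverCore w).Fiber)

/-- The sheet of a point of the cover, continuous on the preimage of the open square. -/
def sheet (e : CoverSpace w) : Fin d := jumpAt w ((coverCore w).indexAt e.1) e.1 e.2

/-- The lift of a path inside a chart is constant in the trivialization over that chart; `a` is this
constant value. -/
theorem monodromy_sheet {χ : Chart} {x y : Surface} (c : Path x y) (hc : ∀ t, c t ∈ χ.carrier)
    (e : (coverCore w).proj ⁻¹' {x}) :
    sheet w ((isCoveringMap_cover w).monodromy (Path.Homotopic.Quotient.mk c) e) =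
      (jumpAt w χ y * (jumpAt w χ x)⁻¹) (sheet w e) := by
  obtain ⟨e, rfl⟩ := e
  set a : Fin d := (jumpAt w χ e.1)⁻¹ (sheet w e) with ha
  let lift : unitInterval → CoverSpace w := fun t =>
    ((coverCore w).localTriv χ).toOpenPartialHomeomorph.symm (c t, a)
  have hlift : ∀ t, lift t = ⟨c t, (jumpAt w ((coverCore w).indexAt (c t)) (c t))⁻¹
      (jumpAt w χ (c t) a)⟩ := fun t => rfl
  have hcont : Continuous lift := by
    refine ContinuousOn.comp_continuous (s := χ.carrier ×ˢ univ)
      ((coverCore w).localTriv χ).toOpenPartialHomeomorph.continuousOn_symm (by fun_prop)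
      fun t => ⟨hc t, mem_univ _⟩
  have h0 : lift 0 = e := by
    rw [hlift, c.source]
    refine congrArg (Bundle.TotalSpace.mk (F := Fin d) (E := (coverCore w).Fiber) e.1) ?_
    exact (congrArg (jumpAt w ((coverCore w).indexAt e.1) e.1).symm
      ((jumpAt w χ e.1).apply_symm_apply _)).trans (Equiv.symm_apply_apply _ _)
  have := (isCoveringMap_cover w).eq_liftPath_iff (γ := (c : C(unitInterval, Surface))) (e := e)
    (γ_0 := c.source) (Γ := lift) |>.mpr ⟨hcont, rfl, h0⟩
  change sheet w ((isCoveringMap_cover w).liftPath c e _ 1) = _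
  rw [← this]
  rw [hlift, c.target]
  exact Equiv.apply_symm_apply (jumpAt w ((coverCore w).indexAt y) y) _

theorem monodromy_sheet_interior {x y : Surface} (c : Path x y)
    (hc : ∀ t, c t ∈ Chart.interior.carrier) (e : (coverCore w).proj ⁻¹' {x}) :
    sheet w ((isCoveringMap_cover w).monodromy (Path.Homotopic.Quotient.mk c) e) = sheet w e := by
  rw [monodromy_sheet w c hc, jumpAt_interior, jumpAt_interior]
  simp

/-- The labelling of the fiber over the basepoint by sheets. -/
def sheetEquiv : Fin d ≃ (coverCore w).proj ⁻¹' {basepoint} where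
  toFun i := ⟨⟨basepoint, (jumpAt w ((coverCore w).indexAt basepoint) basepoint)⁻¹ i⟩, rfl⟩
  invFun e := sheet w e
  left_inv i := by simp [sheet]
  right_inv := by
    rintro ⟨⟨s, v⟩, hs⟩
    obtain rfl : s = basepoint := hs
    refine Subtype.ext (congrArg
      (Bundle.TotalSpace.mk (F := Fin d) (E := (coverCore w).Fiber) basepoint) ?_)
    exact Equiv.symm_apply_apply (jumpAt w ((coverCore w).indexAt basepoint) basepoint) v

/-- The monodromy of the cover with the given monodromy across the edges. -/
def coverHom : Pi1 →* Equiv.Perm (Fin d) :=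
  ((sheetEquiv w).symm.permCongrHom.toMonoidHom).comp
    ((isCoveringMap_cover w).monodromyPerm basepoint)

theorem coverHom_apply (γ : Pi1) (i : Fin d) : coverHom w γ i =
    sheet w ((isCoveringMap_cover w).monodromyPerm basepoint γ (sheetEquiv w i)) := rfl

theorem isCoverOf_coverHom : IsCoverOf (coverCore w).proj (coverHom w) :=
  ⟨isCoveringMap_cover w, sheetEquiv w, fun γ i => by
    rw [coverHom_apply]
    exact ((sheetEquiv w).apply_symm_apply _).symm⟩

/-- The reference paths stay in the open square and preserve the sheet, so only the crossing of the
edge contributes. Since `w` is arbitrary off the trivial generator, the generators satisfy no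
relation. -/
theorem coverHom_gen (hw : w .interior = 1) (χ : Chart) : coverHom w (gen χ) = w χ := by
  ext i
  rw [coverHom_apply, gen, loop]
  simp only [IsCoveringMap.coe_monodromyPerm, Path.Homotopic.Quotient.mk_trans,
    IsCoveringMap.monodromy_trans_apply, Path.Homotopic.Quotient.mk_symm]
  rw [← Path.Homotopic.Quotient.mk_symm, monodromy_sheet_interior,
    monodromy_sheet w (χ := χ) _ fun t => JoinedIn.somePath_mem _ _, monodromy_sheet_interior,
    jumpAt_param w χ.pre_mem, jumpAt_param w χ.post_mem]
  · have h1 : χ.jump w χ.pre = 1 := if_neg (Chart.not_beyond_of_before χ.before_pre)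
    have h2 : χ.jump w χ.post = w χ := by
      cases χ with
      | interior => exact (if_neg id).trans hw.symm
      | vertical k => exact if_pos (by norm_num [Chart.Beyond, Chart.post])
      | horizontal k => exact if_pos (by norm_num [Chart.Beyond, Chart.post])
    rw [h1, h2, inv_one, mul_one]
    exact congrArg (fun j => ((w χ j : Fin d) : ℕ)) ((sheetEquiv w).symm_apply_apply i)
  · exact toPoint_mem χ.pre_mem_interior
  · exact fun t => toPoint_mem χ.post_mem_interior _

end CoverConstruction

variable {d : ℕ}

theorem exists_isCoverOf (h : Pi1 →* Equiv.Perm (Fin d)) :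
    ∃ (E : Type) (_ : TopologicalSpace E) (p : E → Surface), IsCoverOf p h := by
  have e : coverHom (fun χ => h (gen χ)) = h :=
    hom_ext fun χ => coverHom_gen _ (by rw [gen_interior, map_one]) χ
  have := isCoverOf_coverHom (fun χ => h (gen χ))
  rw [e] at this
  exact ⟨_, _, _, this⟩

/-- The fundamental group is freely generated by the loops that cross one edge. -/
theorem exists_hom {G : Subgroup (Equiv.Perm (Fin d))} (w : Chart → G) (hw : w .interior = 1) :
    ∃ h : Pi1 →* G, ∀ χ, h (gen χ) = w χ := by
  set f := coverHom (fun χ => (w χ : Equiv.Perm (Fin d))) with hf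
  have hgen : ∀ χ, f (gen χ) = w χ := coverHom_gen _ (by rw [hw]; rfl)
  have hG : ∀ γ, f γ ∈ G := by
    intro γ
    have h1 : Subgroup.closure (range gen) ≤ G.comap f := by
      rw [Subgroup.closure_le]
      rintro _ ⟨χ, rfl⟩
      change f (gen χ) ∈ G
      rw [hgen]
      exact (w χ).2
    rw [closure_gen] at h1
    exact h1 (Subgroup.mem_top γ)
  exact ⟨f.codRestrict G hG, fun χ => Subtype.ext (hgen χ)⟩

/-! ### The action of the affine automorphism on the generators -/

theorem phi_symm_pt_left {z : ℝ × ℝ} (hz : z ∈ square) (h : z.1 ≤ 1 / 2) :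
    phi.symm (pt z) = pt (2 * z.1, z.2 / 2) := by
  change diagFlip (phiFun (diagFlip (pt z))) = _
  have h' : z.swap.2 ≤ 1 / 2 := h
  rw [diagFlip_pt hz, phiFun_pt (swap_mem hz), phiAux, if_pos h',
    diagFlip_pt (lower_mem (swap_mem hz) h')]
  rfl

theorem phi_symm_pt_right {z : ℝ × ℝ} (hz : z ∈ square) (h : 1 / 2 < z.1) :
    phi.symm (pt z) = pt (2 * z.1 - 1, z.2 / 2 + 1 / 2) := by
  change diagFlip (phiFun (diagFlip (pt z))) = _
  have h' : 1 / 2 < z.swap.2 := h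
  rw [diagFlip_pt hz, phiFun_pt (swap_mem hz), phiAux, if_neg (not_le.mpr h'),
    diagFlip_pt (upper_mem (swap_mem hz) h'.le)]
  rfl

theorem shift_zero : shift 0 = 1 / 2 := by norm_num [shift]

theorem shift_succ (k : ℕ) : shift k = 2 * shift (k + 1) + 1 := by
  simp only [shift, pow_succ]
  ring

theorem far_succ {k : ℕ} {y : ℝ} : y / 2 + 1 / 2 ∈ farInterval (k + 1) ↔ y ∈ farInterval k := by
  simp only [farInterval, mem_Ioo, pow_succ]
  constructor <;> rintro ⟨h1, h2⟩ <;> constructor <;> linarith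

theorem far_pred {k : ℕ} {y : ℝ} (h : y ∈ farInterval (k + 1)) : 2 * y - 1 ∈ farInterval k := by
  rw [← far_succ]
  convert h using 1
  ring

/-- Stretched to width 2 and height 1/2, the open square is exactly the domain of the chart across
the vertical edge 0. Paths in the square are therefore carried across that edge alone. -/
theorem phi_symm_interior {z : ℝ × ℝ} (hz : z ∈ Chart.interior.dom) :
    (2 * z.1, z.2 / 2) ∈ (Chart.vertical 0).dom ∧
      phi.symm (Chart.interior.param z) = (Chart.vertical 0).param (2 * z.1, z.2 / 2) := by
  have hz' : (2 * z.1, z.2 / 2) ∈ (Chart.vertical 0).dom := by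
    obtain ⟨⟨h1, h2⟩, h3, h4⟩ := hz
    refine ⟨⟨?_, ?_⟩, ?_⟩
    · simp only; linarith
    · simp only; linarith
    · rw [far_zero]
      simp only
      constructor <;> linarith
  refine ⟨hz', ?_⟩
  have hsq : z ∈ square := Or.inl hz
  rcases le_or_gt z.1 (1 / 2) with h | h
  · rw [Chart.param_vertical_of_le (by simp only; linarith)]
    exact phi_symm_pt_left hsq h
  · rw [Chart.param_vertical_of_ge hz' (by simp only; linarith), shift_zero]
    exact phi_symm_pt_right hsq h

/-- Only the middle half of the chart domain is used, since its stretched image already has the full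
width 2 of the next chart. -/
theorem phi_symm_vertical {k : ℕ} {z : ℝ × ℝ} (hz : z ∈ (Chart.vertical k).dom)
    (h1 : 1 / 2 < z.1) (h2 : z.1 < 3 / 2) :
    (2 * z.1 - 1, z.2 / 2 + 1 / 2) ∈ (Chart.vertical (k + 1)).dom ∧
      phi.symm ((Chart.vertical k).param z) =
        (Chart.vertical (k + 1)).param (2 * z.1 - 1, z.2 / 2 + 1 / 2) := by
  have hz' : (2 * z.1 - 1, z.2 / 2 + 1 / 2) ∈ (Chart.vertical (k + 1)).dom :=
    ⟨⟨by simp only; linarith, by simp only; linarith⟩, far_succ.mpr hz.2⟩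
  refine ⟨hz', ?_⟩
  rcases le_or_gt z.1 1 with h | h
  · rw [Chart.param_vertical_of_le h, Chart.param_vertical_of_le (by simp only; linarith),
      phi_symm_pt_right (vertical_before_mem hz h) h1]
  · rw [Chart.param_vertical_of_ge hz h.le, Chart.param_vertical_of_ge hz' (by simp only; linarith),
      phi_symm_pt_left (vertical_beyond_mem hz h.le) (by simp only; linarith), shift_succ k]
    congr 1
    ext <;> simp only <;> ring

theorem horizontal_before_mem {k : ℕ} {z : ℝ × ℝ} (hz : z ∈ (Chart.horizontal k).dom)
    (h : z.2 ≤ 1) : z ∈ square := by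
  have := swap_mem (vertical_before_mem (swap_mem_vertical_dom.mpr hz) (by exact h))
  rwa [Prod.swap_swap] at this

theorem phi_symm_horizontal_succ {k : ℕ} {z : ℝ × ℝ} (hz : z ∈ (Chart.horizontal (k + 1)).dom) :
    (2 * z.1 - 1, z.2 / 2 + 1 / 2) ∈ (Chart.horizontal k).dom ∧
      phi.symm ((Chart.horizontal (k + 1)).param z) =
        (Chart.horizontal k).param (2 * z.1 - 1, z.2 / 2 + 1 / 2) := by
  have hz' : (2 * z.1 - 1, z.2 / 2 + 1 / 2) ∈ (Chart.horizontal k).dom :=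
    ⟨far_pred hz.1, ⟨by simp only; linarith [hz.2.1], by simp only; linarith [hz.2.2]⟩⟩
  refine ⟨hz', ?_⟩
  have hl := near_lt_half (near_of_far hz.1)
  simp only [Chart.param]
  rcases le_or_gt z.2 1 with h | h
  · rw [if_pos h, if_pos (by linarith),
      phi_symm_pt_right (horizontal_before_mem hz h) (half_lt_far hz.1)]
  · have := Chart.param_beyond hz h
    rw [if_neg (not_le.mpr h), if_neg (by linarith)]
    rw [phi_symm_pt_left (z := (z.1 + shift (k + 1), z.2 - 1)) (Or.inl this.1) hl.le, shift_succ k]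
    congr 1
    ext <;> simp only <;> ring

/-- Here the chart domain `(0, 1/2) × (0, 2)` becomes the open square, and the edge becomes its
segment at height 1/2: this crossing disappears. -/
theorem phi_symm_horizontal_zero {z : ℝ × ℝ} (hz : z ∈ (Chart.horizontal 0).dom) :
    (2 * z.1, z.2 / 2) ∈ Chart.interior.dom ∧
      phi.symm ((Chart.horizontal 0).param z) = Chart.interior.param (2 * z.1, z.2 / 2) := by
  have h0 := far_zero.mp hz.1
  have hz' : (2 * z.1, z.2 / 2) ∈ Chart.interior.dom :=
    ⟨⟨by simp only; linarith, by simp only; linarith⟩,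
      ⟨by simp only; linarith [hz.2.1], by simp only; linarith [hz.2.2]⟩⟩
  refine ⟨hz', ?_⟩
  simp only [Chart.param]
  rcases le_or_gt z.2 1 with h | h
  · rw [if_pos h, phi_symm_pt_left (horizontal_before_mem hz h) h0.2.le]
  · have := Chart.param_beyond hz h
    rw [if_neg (not_le.mpr h), phi_symm_pt_right (z := (z.1 + shift 0, z.2 - 1)) (Or.inl this.1)
      (by simp only [shift_zero]; linarith), shift_zero]
    congr 1
    ext <;> simp only <;> ring

theorem loop_map_phi_symm {χ χ' : Chart} {C : Set (ℝ × ℝ)} {f : ℝ × ℝ → ℝ × ℝ}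
    (hf : ∀ z ∈ C, f z ∈ χ'.dom ∧ phi.symm (χ.param z) = χ'.param (f z))
    {x y : Surface} (c : Path x y) (hc : ∀ t, c t ∈ χ.param '' C) {z z' : ℝ × ℝ} (hz : z ∈ C)
    (hz' : z' ∈ C) (hx : χ.param z = x) (hy : χ.param z' = y) :
    loop (c.map phi.symm.continuous) = χ'.jump gen (f z') * (χ'.jump gen (f z))⁻¹ := by
  refine loop_of_chart (hf z hz).1 (hf z' hz').1 _ ?_ ?_ fun t => ?_
  · rw [← (hf z hz).2, hx]
  · rw [← (hf z' hz').2, hy]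
  · obtain ⟨u, hu, h⟩ := hc t
    exact ⟨f u, (hf u hu).1, by rw [← (hf u hu).2, h]; rfl⟩

/-- The image of a reference path crosses the vertical edge 0 exactly when the endpoint lies in the
right half of the square. This is the source of the factors `gen (.vertical 0)` below. -/
theorem loop_map_toPoint {z : ℝ × ℝ} (hz : z ∈ Chart.interior.dom) {s : Surface} (hs : s = pt z) :
    loop ((toPoint s).map phi.symm.continuous) =
      if 1 / 2 < z.1 then gen (.vertical 0) else 1 := by
  obtain rfl : s = Chart.interior.param z := hs
  rw [loop_map_phi_symm (χ := .interior) (fun z hz => phi_symm_interior hz) _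
    (toPoint_mem ⟨z, hz, rfl⟩) (Chart.pre_mem .interior) hz rfl rfl]
  have h1 : ¬ (Chart.vertical 0).Beyond (2 * Chart.interior.pre.1, Chart.interior.pre.2 / 2) := by
    norm_num [Chart.Beyond, Chart.pre]
  have h2 : (Chart.vertical 0).Beyond (2 * z.1, z.2 / 2) ↔ 1 / 2 < z.1 := by
    change 1 < 2 * z.1 ↔ _
    constructor <;> intro h <;> linarith
  rw [Chart.jump, Chart.jump, if_neg h1, inv_one, mul_one]
  simp only [h2]

/-- The images of the two reference paths correct the image of the path itself; `delta` stays in the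
open square and contributes nothing. -/
theorem phiInvDelta_loop {x y : Surface} (c : Path x y) :
    phiInvDelta (loop c) = (loop ((toPoint y).map phi.symm.continuous))⁻¹ *
      loop (c.map phi.symm.continuous) * loop ((toPoint x).map phi.symm.continuous) := by
  have hd : loop delta = 1 := by
    refine loop_of_interior _ fun t => ⟨((1 + (t : ℝ)) / 8, (2 - (t : ℝ)) / 16), ?_, rfl⟩
    have h0 := t.2.1
    have h1 := t.2.2
    exact ⟨⟨by simp only; linarith, by simp only; linarith⟩,
      by simp only; linarith, by simp only; linarith⟩
  rw [loop, phiInvDelta_mk, ← loop_basepoint, loop_trans, loop_trans, loop_symm, hd, Path.map_trans,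
    Path.map_trans, loop_trans, loop_trans, ← Path.map_symm, loop_symm, inv_one, one_mul, mul_one]

/-- The crossing path may be moved into a convex set `C` on which `φ⁻¹` has values in a single
chart. What remains is to see on which side of `x = 1/2` each endpoint lies in the square, and where
the images of `pre` and `post` lie relative to the edge of `χ'`. -/
theorem phiInvDelta_gen_aux {χ χ' : Chart} {C : Set (ℝ × ℝ)} (hC : Convex ℝ C)
    (hCd : C ⊆ χ.dom) {f : ℝ × ℝ → ℝ × ℝ}
    (hf : ∀ z ∈ C, f z ∈ χ'.dom ∧ phi.symm (χ.param z) = χ'.param (f z))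
    (hpre : χ.pre ∈ C) (hpost : χ.post ∈ C) (hb : χ.Beyond χ.post) :
    phiInvDelta (gen χ) = (if 1 / 2 < (χ.back χ.post).1 then gen (.vertical 0) else 1)⁻¹ *
      (χ'.jump gen (f χ.post) * (χ'.jump gen (f χ.pre))⁻¹) *
      (if 1 / 2 < χ.pre.1 then gen (.vertical 0) else 1) := by
  obtain ⟨c, hc⟩ := Chart.exists_path_of_convex hC hCd hpre hpost
  have h1 : gen χ = loop c :=
    loop_congr (Chart.homotopic _ _ (JoinedIn.somePath_mem _) fun t => image_mono hCd (hc t))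
  have h2 := Chart.param_before χ.pre_mem χ.before_pre
  have h3 := Chart.param_beyond χ.post_mem hb
  rw [h1, phiInvDelta_loop, loop_map_toPoint h2.1 h2.2, loop_map_toPoint h3.1 h3.2,
    loop_map_phi_symm hf c hc hpre hpost rfl rfl]

theorem phiInvDelta_gen_vertical (k : ℕ) :
    phiInvDelta (gen (.vertical k)) = gen (.vertical (k + 1)) * gen (.vertical 0) := by
  have hb : (Chart.vertical k).Beyond (Chart.vertical k).post := by
    norm_num [Chart.Beyond, Chart.post]
  rw [phiInvDelta_gen_aux (χ := .vertical k) (χ' := .vertical (k + 1))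
    (C := Ioo (1 / 2) (3 / 2) ×ˢ farInterval k) (f := fun z => (2 * z.1 - 1, z.2 / 2 + 1 / 2))
    ((convex_Ioo _ _).prod (convex_Ioo _ _)) _ _ _ _ hb]
  · have h1 : (Chart.vertical (k + 1)).jump gen (2 * (Chart.vertical k).pre.1 - 1,
        (Chart.vertical k).pre.2 / 2 + 1 / 2) = 1 :=
      if_neg (by norm_num [Chart.Beyond, Chart.pre])
    have h2 : (Chart.vertical (k + 1)).jump gen (2 * (Chart.vertical k).post.1 - 1,
        (Chart.vertical k).post.2 / 2 + 1 / 2) = gen (.vertical (k + 1)) :=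
      if_pos (by norm_num [Chart.Beyond, Chart.post])
    rw [h1, h2, if_neg (by norm_num [Chart.back, Chart.post]), if_pos (by norm_num [Chart.pre]), inv_one,
      one_mul, mul_one]
  · rintro z ⟨⟨h1, h2⟩, h3⟩
    exact ⟨⟨by linarith, by linarith⟩, h3⟩
  · rintro z ⟨⟨h1, h2⟩, h3⟩
    exact phi_symm_vertical ⟨⟨by linarith, by linarith⟩, h3⟩ h1 h2
  · exact ⟨by norm_num [Chart.pre], farMid_mem k⟩
  · exact ⟨by norm_num [Chart.post], farMid_mem k⟩

theorem phiInvDelta_gen_horizontal_succ (k : ℕ) :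
    phiInvDelta (gen (.horizontal (k + 1))) = gen (.horizontal k) * gen (.vertical 0) := by
  have hb : (Chart.horizontal (k + 1)).Beyond (Chart.horizontal (k + 1)).post := by
    norm_num [Chart.Beyond, Chart.post]
  rw [phiInvDelta_gen_aux (χ := .horizontal (k + 1)) (χ' := .horizontal k)
    (f := fun z => (2 * z.1 - 1, z.2 / 2 + 1 / 2))
    (Chart.convex_dom _) Subset.rfl (fun z hz => phi_symm_horizontal_succ hz) (Chart.pre_mem _)
    (Chart.post_mem _) hb]
  have h1 : (Chart.horizontal k).jump gen (2 * (Chart.horizontal (k + 1)).pre.1 - 1,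
      (Chart.horizontal (k + 1)).pre.2 / 2 + 1 / 2) = 1 :=
    if_neg (by norm_num [Chart.Beyond, Chart.pre])
  have h2 : (Chart.horizontal k).jump gen (2 * (Chart.horizontal (k + 1)).post.1 - 1,
      (Chart.horizontal (k + 1)).post.2 / 2 + 1 / 2) = gen (.horizontal k) :=
    if_pos (by norm_num [Chart.Beyond, Chart.post])
  have h3 : 1 / 2 < (Chart.horizontal (k + 1)).pre.1 := half_lt_far (farMid_mem (k + 1))
  have h4 : ¬ 1 / 2 < ((Chart.horizontal (k + 1)).back (Chart.horizontal (k + 1)).post).1 :=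
    not_lt.mpr (near_lt_half (near_of_far (farMid_mem (k + 1)))).le
  rw [h1, h2, if_neg h4, if_pos h3, inv_one, one_mul, mul_one]

theorem phiInvDelta_gen_horizontal_zero :
    phiInvDelta (gen (.horizontal 0)) = (gen (.vertical 0))⁻¹ := by
  have hb : (Chart.horizontal 0).Beyond (Chart.horizontal 0).post := by
    norm_num [Chart.Beyond, Chart.post]
  rw [phiInvDelta_gen_aux (χ := .horizontal 0) (χ' := .interior)
    (f := fun z => (2 * z.1, z.2 / 2))
    (Chart.convex_dom _) Subset.rfl (fun z hz => phi_symm_horizontal_zero hz) (Chart.pre_mem _)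
    (Chart.post_mem _) hb]
  have h3 : ¬ 1 / 2 < (Chart.horizontal 0).pre.1 := not_lt.mpr (far_zero.mp (farMid_mem 0)).2.le
  have h4 : 1 / 2 < ((Chart.horizontal 0).back (Chart.horizontal 0).post).1 :=
    (near_zero.mp (near_of_far (farMid_mem 0))).1
  have h5 : ∀ z, Chart.interior.jump gen z = 1 := fun z => if_neg id
  rw [h5, h5, if_neg h3, if_pos h4, inv_one, mul_one, mul_one, mul_one]

/-! ### Dynamics on the space of homomorphisms -/

/-- The orbit of a generator under the automorphism of the fundamental group. -/
def orb (n : ℕ) : Pi1 := phiInvDelta^[n] (gen (.horizontal 0))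

theorem phiInvDelta_orb (n : ℕ) : phiInvDelta (orb n) = orb (n + 1) :=
  (Function.iterate_succ_apply' _ _ _).symm

theorem iterate_orb (m n : ℕ) : phiInvDelta^[m] (orb n) = orb (m + n) :=
  (Function.iterate_add_apply _ _ _ _).symm

theorem orb_one : orb 1 = (gen (.vertical 0))⁻¹ := phiInvDelta_gen_horizontal_zero

/-- The product `A k * ⋯ * A 1`. -/
def lprod {K : Type*} [Group K] (A : ℕ → K) : ℕ → K
  | 0 => 1
  | k + 1 => A (k + 1) * lprod A k

theorem map_lprod {K L : Type*} [Group K] [Group L] (f : K →* L) (A : ℕ → K) (k : ℕ) :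
    f (lprod A k) = lprod (fun n => f (A n)) k := by
  induction k with
  | zero => exact map_one f
  | succ k ih => rw [lprod, map_mul, ih, lprod]

theorem lprod_congr {K : Type*} [Group K] {A B : ℕ → K} {k : ℕ}
    (h : ∀ n, 1 ≤ n → n ≤ k → A n = B n) : lprod A k = lprod B k := by
  induction k with
  | zero => rfl
  | succ k ih =>
    rw [lprod, lprod, ih fun n h1 h2 => h n h1 (h2.trans k.le_succ), h _ (by omega) le_rfl]

theorem lprod_mem {K : Type*} [Group K] {N : Subgroup K} {A : ℕ → K} (h : ∀ n, 1 ≤ n → A n ∈ N)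
    (k : ℕ) : lprod A k ∈ N := by
  induction k with
  | zero => exact N.one_mem
  | succ k ih => exact N.mul_mem (h _ (by omega)) ih

/-- The relation `φ_δ⁻¹(v_k) = v_{k+1} v_0` with `v_0 = (orb 1)⁻¹` gives `v_{k+1} = φ_δ⁻¹(v_k) · orb
1`, a recursion that the product solves. The vertical generators can thus be traded for the points
of one orbit. -/
theorem gen_vertical_eq (k : ℕ) : gen (.vertical k) = (orb (k + 1))⁻¹ * lprod orb k := by
  induction k with
  | zero => rw [orb_one, inv_inv, lprod, mul_one]
  | succ k ih =>
    -- The automorphism shifts all factors of the product by one, and `orb 1` supplies the missing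
    -- last factor.
    have h1 : ∀ m, lprod (fun n => phiInvDelta (orb n)) m * orb 1 = lprod orb (m + 1) := by
      intro m
      induction m with
      | zero => simp only [lprod, one_mul, mul_one, zero_add]
      | succ m ihm => rw [lprod, mul_assoc, ihm, phiInvDelta_orb, lprod, lprod, lprod]
    have h2 : gen (.vertical (k + 1)) = phiInvDelta (gen (.vertical k)) * orb 1 := by
      rw [phiInvDelta_gen_vertical, orb_one, mul_inv_cancel_right]
    rw [h2, ih, map_mul, map_inv, phiInvDelta_orb, map_lprod, mul_assoc, h1]

variable {d : ℕ} {G : Subgroup (Equiv.Perm (Fin d))}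

theorem iter_apply (h : Pi1 →* G) (n : ℕ) (γ : Pi1) : iter h n γ = h (phiInvDelta^[n] γ) := by
  induction n generalizing γ with
  | zero => rfl
  | succ n ih =>
    have : iter h (n + 1) = (iter h n).comp phiInvDelta := Function.iterate_succ_apply' _ _ _
    rw [this, MonoidHom.comp_apply, ih, Function.iterate_succ_apply]

theorem iter_orb (h : Pi1 →* G) (n j : ℕ) : iter h n (orb j) = h (orb (n + j)) := by
  rw [iter_apply, iterate_orb]

theorem iter_gen_vertical_mem {H : Subgroup (Equiv.Perm (Fin d))} {h : Pi1 →* G} {N : ℕ}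
    (hN : ∀ n, N ≤ n → (h (orb n) : Equiv.Perm (Fin d)) ∈ H) (k : ℕ) :
    (iter h N (gen (.vertical k)) : Equiv.Perm (Fin d)) ∈ H := by
  have h1 : ∀ n, iter h N (orb n) ∈ H.comap G.subtype := fun n => by
    rw [iter_orb]
    exact hN _ (Nat.le_add_right _ _)
  rw [gen_vertical_eq, map_mul, map_inv, map_lprod]
  exact (H.comap G.subtype).mul_mem (inv_mem (h1 _)) (lprod_mem (fun n _ => h1 n) k)

/-- The elements eventually sent into `H` form a subgroup, so generators suffice. The vertical ones
are words in the orbit. For the horizontal ones, induct on the index: one application of the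
automorphism turns `h_{k+1}` into `h_k v_0`. The time needed depends on the element. -/
theorem eventually_iter_mem {H : Subgroup (Equiv.Perm (Fin d))} {h : Pi1 →* G} {N : ℕ}
    (hN : ∀ n, N ≤ n → (h (orb n) : Equiv.Perm (Fin d)) ∈ H) (γ : Pi1) :
    ∀ᶠ n in atTop, (iter h n γ : Equiv.Perm (Fin d)) ∈ H := by
  let S : Subgroup Pi1 :=
    { carrier := {γ | ∀ᶠ n in atTop, (iter h n γ : Equiv.Perm (Fin d)) ∈ H}
      mul_mem' := fun {a b} ha hb => by
        filter_upwards [ha, hb] with n h1 h2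
        rw [map_mul]
        exact H.mul_mem h1 h2
      one_mem' := Eventually.of_forall fun n => by
        rw [map_one]
        exact H.one_mem
      inv_mem' := fun {a} ha => by
        filter_upwards [ha] with n h1
        rw [map_inv]
        exact H.inv_mem h1 }
  have hv : ∀ k, gen (.vertical k) ∈ S := by
    intro k
    refine eventually_atTop.mpr ⟨N, fun n hn => ?_⟩
    exact iter_gen_vertical_mem (fun m hm => hN m (hn.trans hm)) k
  have hh : ∀ k, gen (.horizontal k) ∈ S := by
    intro k
    induction k with
    | zero =>
      refine eventually_atTop.mpr ⟨N, fun n hn => ?_⟩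
      have := iter_orb h n 0
      rw [orb, Function.iterate_zero_apply] at this
      rw [this]
      exact hN _ hn
    | succ k ih =>
      have h1 : phiInvDelta (gen (.horizontal (k + 1))) ∈ S := by
        rw [phiInvDelta_gen_horizontal_succ]
        exact S.mul_mem ih (hv 0)
      change ∀ᶠ n in atTop, (iter h n (gen (.horizontal (k + 1))) : Equiv.Perm (Fin d)) ∈ H
      rw [← map_add_atTop_eq_nat 1, eventually_map]
      filter_upwards [show ∀ᶠ n in atTop,
        (iter h n (phiInvDelta (gen (.horizontal (k + 1)))) : Equiv.Perm (Fin d)) ∈ H from h1]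
        with n hn
      rwa [iter_apply, Function.iterate_succ_apply, ← iter_apply]
  have htop : Subgroup.closure (range gen) ≤ S := by
    rw [Subgroup.closure_le]
    rintro _ ⟨χ, rfl⟩
    cases χ with
    | interior =>
      rw [gen_interior]
      exact S.one_mem
    | vertical k => exact hv k
    | horizontal k => exact hh k
  rw [closure_gen] at htop
  exact htop (Subgroup.mem_top γ)

/-! ### Compactness of the space of homomorphisms -/

theorem isOpen_eval (γ : Pi1) (P : Equiv.Perm (Fin d) → Prop) :
    IsOpen {l : Pi1 →* G | P (l γ)} := by
  let : TopologicalSpace G := ⊥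
  have : DiscreteTopology G := ⟨rfl⟩
  have h1 : Continuous fun l : Pi1 →* G => (fun γ => l γ : Pi1 → G) := continuous_induced_dom
  exact (isOpen_discrete {g : G | P g}).preimage ((continuous_apply γ).comp h1)

instance compactSpace_hom : CompactSpace (Pi1 →* G) := by
  let : TopologicalSpace G := ⊥
  have : DiscreteTopology G := ⟨rfl⟩
  have hcl : IsClosed (range fun l : Pi1 →* G => (fun γ => l γ : Pi1 → G)) := by
    have : (range fun l : Pi1 →* G => (fun γ => l γ : Pi1 → G)) =
        ⋂ (a : Pi1) (b : Pi1), {f | f (a * b) = f a * f b} := by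
      ext f
      simp only [mem_range, mem_iInter, mem_ofPred_eq]
      constructor
      · rintro ⟨l, rfl⟩ a b
        exact map_mul l a b
      · exact fun h => ⟨MonoidHom.mk' f h, rfl⟩
    rw [this]
    refine isClosed_iInter fun a => isClosed_iInter fun b => isClosed_eq (continuous_apply _) ?_
    exact (continuous_apply a).mul (continuous_apply b)
  have : IsClosedEmbedding fun l : Pi1 →* G => (fun γ => l γ : Pi1 → G) :=
    ⟨⟨⟨rfl⟩, fun l l' h => MonoidHom.ext fun γ => congrFun h γ⟩, hcl⟩
  exact this.compactSpace

/-- If `h(orb n) ∉ H` for infinitely many `n`, compactness yields an accumulation point along these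
`n`. Its value at `orb 0` lies outside `H`, because evaluation at `orb 0` is locally constant and
`iter h n` takes the value `h(orb n)` there. -/
theorem exists_forall_orb_mem {H : Subgroup (Equiv.Perm (Fin d))} {h : Pi1 →* G}
    (hH : ∀ k : Pi1 →* G, MapClusterPt k atTop (iter h) → ValuedIn H k) :
    ∃ N, ∀ n, N ≤ n → (h (orb n) : Equiv.Perm (Fin d)) ∈ H := by
  rw [← eventually_atTop]
  by_contra hc
  rw [not_eventually, frequently_iff_neBot] at hc
  obtain ⟨k, hk⟩ := exists_clusterPt_of_compactSpace (map (iter h)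
    (atTop ⊓ 𝓟 {n | ¬(h (orb n) : Equiv.Perm (Fin d)) ∈ H}))
  have hk1 : MapClusterPt k atTop (iter h) := ClusterPt.mono hk (map_mono inf_le_left)
  have hk2 := hH k hk1 (orb 0)
  have hk3 := MapClusterPt.frequently (u := iter h) hk
    ((isOpen_eval (G := G) (orb 0) (· ∈ H)).mem_nhds hk2)
  refine hk3 ?_
  rw [eventually_inf_principal]
  refine Eventually.of_forall fun n hn hn' => hn ?_
  simp only [iter_orb, add_zero] at hn'
  exact hn'

/-! ### The space of covers -/

theorem cov_eq_iff {h k : Pi1 →* G} : Cov.mk h = Cov.mk k ↔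
    ∃ σ : Equiv.Perm (Fin d), ∀ γ, (k γ : Equiv.Perm (Fin d)) = σ * h γ * σ⁻¹ :=
  Quotient.eq (r := conjSetoid G)

/-- A conjugation-invariant open set of homomorphisms is the preimage of an open set of classes, so
accumulation in the quotient can be tested upstairs. -/
theorem frequently_mem_of_mapClusterPt {u : ℕ → Pi1 →* G} {k : Pi1 →* G}
    (hk : MapClusterPt (Cov.mk k) atTop fun n => Cov.mk (u n)) {W : Set (Pi1 →* G)}
    (hW : IsOpen W) (hkW : k ∈ W) (hs : ∀ l l', Cov.mk l = Cov.mk l' → l ∈ W → l' ∈ W) :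
    ∃ᶠ n in atTop, u n ∈ W := by
  have h1 : Cov.mk ⁻¹' (Cov.mk '' W) = W := by
    refine Subset.antisymm ?_ (subset_preimage_image _ _)
    rintro l ⟨l', hl', h⟩
    exact hs _ _ h hl'
  have h2 : IsOpen (Cov.mk '' W) := isOpen_coinduced.mpr (h1.symm ▸ hW)
  refine (hk.frequently (h2.mem_nhds ⟨k, hkW, rfl⟩)).mono fun n hn => ?_
  rw [← h1]
  exact hn

theorem mem_covIn_of_cluster {H : Subgroup (Equiv.Perm (Fin d))} (hHG : H ≤ G) {h : Pi1 →* G}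
    {N : ℕ} (hN : ∀ n, N ≤ n → (h (orb n) : Equiv.Perm (Fin d)) ∈ H) {c : Cov G}
    (hc : MapClusterPt c atTop fun n => Cov.mk (iter h n)) : c ∈ covIn G H := by
  induction c using Quotient.ind with | _ k
  change MapClusterPt (Cov.mk k) atTop _ at hc
  by_contra hn
  have h1 : ∀ σ : Equiv.Perm (Fin d), ∃ γ, σ * k γ * σ⁻¹ ∉ H := by
    intro σ
    by_contra! hσ
    refine hn ⟨MonoidHom.mk' (fun γ => ⟨σ * k γ * σ⁻¹, hHG (hσ γ)⟩) fun a b => ?_, hσ, ?_⟩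
    · ext1
      simp only [map_mul, Subgroup.coe_mul]
      group
    · exact (cov_eq_iff.mpr ⟨σ, fun γ => rfl⟩).symm
  choose γ hγ using h1
  -- If no conjugate of `k` has values in `H`, one witness per permutation shows it. Being finite in
  -- number, the witnesses define an open condition; letting `τ` vary freely makes it invariant
  -- under conjugation.
  have h2 := frequently_mem_of_mapClusterPt hc
    (W := {l | ∀ σ : Equiv.Perm (Fin d), ∃ τ, σ * l (γ τ) * σ⁻¹ ∉ H}) ?_
    (fun σ => ⟨σ, hγ σ⟩) ?_
  · refine h2 ?_
    have h3 : ∀ᶠ n in atTop, ∀ τ, (iter h n (γ τ) : Equiv.Perm (Fin d)) ∈ H :=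
      eventually_all.mpr fun τ => eventually_iter_mem hN (γ τ)
    filter_upwards [h3] with n hn hn'
    obtain ⟨τ, hτ⟩ := hn' 1
    exact hτ (by simpa using hn τ)
  · simp only [ofPred_forall, ofPred_exists]
    exact isOpen_iInter_of_finite fun σ => isOpen_iUnion fun τ =>
      isOpen_eval (γ τ) fun g => σ * g * σ⁻¹ ∉ H
  · intro l l' hll hl σ
    obtain ⟨ρ, hρ⟩ := cov_eq_iff.mp hll
    obtain ⟨τ, hτ⟩ := hl (σ * ρ)
    refine ⟨τ, ?_⟩
    rw [hρ]
    convert hτ using 2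
    group

/-- Beyond `N`, any `L + 1` consecutive values of `h` on the orbit exhaust `H`. A limit with values
in `H'` would force a conjugate of `H` into `H'`, which is too small. -/
theorem notMem_covIn_of_cluster {H H' : Subgroup (Equiv.Perm (Fin d))} (hH : H' < H)
    {h : Pi1 →* G} {N L : ℕ}
    (hN : ∀ n, N ≤ n → ∀ g ∈ H, ∃ j ≤ L, (h (orb (n + j)) : Equiv.Perm (Fin d)) = g) {c : Cov G}
    (hc : MapClusterPt c atTop fun n => Cov.mk (iter h n)) : c ∉ covIn G H' := by
  rintro ⟨k, hk, rfl⟩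
  have h2 := frequently_mem_of_mapClusterPt hc
    (W := {l | ∃ σ : Equiv.Perm (Fin d), ∀ j : Fin (L + 1), σ * l (orb j) * σ⁻¹ ∈ H'}) ?_
    ⟨1, fun j => by simpa using hk (orb j)⟩ ?_
  · obtain ⟨n, ⟨σ, hσ⟩, hn⟩ := (h2.and_eventually (eventually_ge_atTop N)).exists
    have h3 : H.map (MulAut.conj σ).toMonoidHom ≤ H' := by
      rintro _ ⟨g, hg, rfl⟩
      obtain ⟨j, hj, hjg⟩ := hN n hn g hg
      have := hσ ⟨j, by omega⟩
      rw [iter_orb, hjg] at this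
      exact this
    have h4 : Nat.card H = Nat.card (H.map (MulAut.conj σ).toMonoidHom) :=
      Nat.card_congr (H.equivMapOfInjective _ (MulAut.conj σ).injective).toEquiv
    have h5 := Nat.card_mono (Set.toFinite (H' : Set (Equiv.Perm (Fin d)))) h3
    have h6 := Set.Finite.card_lt_card (Set.toFinite (H : Set (Equiv.Perm (Fin d)))) hH
    change Nat.card H' < Nat.card H at h6
    change Nat.card (H.map (MulAut.conj σ).toMonoidHom) ≤ Nat.card H' at h5
    omega
  · simp only [ofPred_forall, ofPred_exists]
    exact isOpen_iUnion fun σ => isOpen_iInter_of_finite fun j =>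
      isOpen_eval (orb j) fun g => σ * g * σ⁻¹ ∈ H'
  · rintro l l' hll ⟨σ, hl⟩
    obtain ⟨ρ, hρ⟩ := cov_eq_iff.mp hll
    refine ⟨σ * ρ⁻¹, fun j => ?_⟩
    rw [hρ]
    convert hl j using 1
    group

/-! ### Homomorphisms with prescribed values -/

theorem exists_periodic (K : Type*) [Finite K] [Nonempty K] :
    ∃ (f : ℕ → K) (L : ℕ), ∀ n g, ∃ j ≤ L, f (n + j) = g := by
  obtain ⟨L, ⟨e⟩⟩ := Finite.exists_equiv_fin K
  have hL : 0 < L := by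
    obtain ⟨k⟩ := ‹Nonempty K›
    exact (Nat.zero_le _).trans_lt (e k).2
  refine ⟨fun k => e.symm ⟨k % L, Nat.mod_lt _ hL⟩, 2 * L, fun n g => ?_⟩
  have h1 := Nat.mod_lt n hL
  -- Advance to the next multiple of `L`, then by the position of `g` in the period; together at
  -- most `2 * L` steps.
  refine ⟨L - n % L + e g, by have := (e g).2; omega, ?_⟩
  rw [Equiv.symm_apply_eq]
  ext
  simp only
  have h2 : n + (L - n % L + (e g : ℕ)) = (e g : ℕ) + L * (n / L + 1) := by
    have := Nat.mod_add_div n L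
    rw [mul_add, mul_one]
    omega
  rw [h2, Nat.add_mul_mod_self_left, Nat.mod_eq_of_lt (e g).2]

/-- The position of a chart in the list of the edges. -/
def Chart.rank : Chart → ℕ
  | interior => 0
  | vertical k => k
  | horizontal k => k

theorem monotone_closure_rank :
    Monotone fun M => Subgroup.closure (gen '' {χ : Chart | χ.rank < M}) :=
  fun _ _ h => Subgroup.closure_mono (image_mono fun _ hχ => lt_of_lt_of_le hχ h)

theorem eq_of_mem_closure_rank {K : Type*} [Group K] {h h₀ : Pi1 →* K} {M : ℕ}
    (hgen : ∀ χ : Chart, χ.rank < M → h (gen χ) = h₀ (gen χ)) {γ : Pi1}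
    (hγ : γ ∈ Subgroup.closure (gen '' {χ | χ.rank < M})) : h γ = h₀ γ := by
  induction hγ using Subgroup.closure_induction with
  | mem x hx =>
    obtain ⟨χ, hχ, rfl⟩ := hx
    exact hgen χ hχ
  | one => rw [map_one, map_one]
  | mul x y _ _ hx hy => rw [map_mul, map_mul, hx, hy]
  | inv x _ hx => rw [map_inv, map_inv, hx]

theorem exists_mem_closure_rank (γ : Pi1) :
    ∃ M, γ ∈ Subgroup.closure (gen '' {χ | χ.rank < M}) := by
  have h : γ ∈ Subgroup.closure (range gen) := closure_gen ▸ Subgroup.mem_top γ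
  induction h using Subgroup.closure_induction with
  | mem x hx =>
    obtain ⟨χ, rfl⟩ := hx
    exact ⟨χ.rank + 1, Subgroup.subset_closure ⟨χ, Nat.lt_succ_self _, rfl⟩⟩
  | one => exact ⟨0, Subgroup.one_mem _⟩
  | mul x y _ _ hx hy =>
    obtain ⟨M, hM⟩ := hx
    obtain ⟨M', hM'⟩ := hy
    exact ⟨max M M', Subgroup.mul_mem _ (monotone_closure_rank (le_max_left _ _) hM)
      (monotone_closure_rank (le_max_right _ _) hM')⟩
  | inv x _ hx =>
    obtain ⟨M, hM⟩ := hx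
    exact ⟨M, Subgroup.inv_mem _ hM⟩

/-- A basic neighbourhood fixes the values at finitely many elements, and these are words in
finitely many generators. -/
theorem exists_rank_of_isOpen {U : Set (Pi1 →* G)} (hU : IsOpen U) {h₀ : Pi1 →* G}
    (hh : h₀ ∈ U) :
    ∃ M, ∀ h : Pi1 →* G, (∀ χ : Chart, χ.rank < M → h (gen χ) = h₀ (gen χ)) → h ∈ U := by
  let : TopologicalSpace G := ⊥
  obtain ⟨V, hV, hVU⟩ : ∃ V : Set (Pi1 → G), IsOpen V ∧
    (fun l : Pi1 →* G => (fun γ => l γ : Pi1 → G)) ⁻¹' V = U := isOpen_induced_iff.mp hU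
  have hmem : ∀ l : Pi1 →* G, l ∈ U ↔ (fun γ => l γ) ∈ V := fun l => by rw [← hVU]; rfl
  obtain ⟨F, u, hu, hFV⟩ := isOpen_pi_iff.mp hV _ ((hmem h₀).mp hh)
  obtain ⟨M, hM⟩ : ∃ M, ∀ γ ∈ F, γ ∈ Subgroup.closure (gen '' {χ | χ.rank < M}) := by
    choose M hM using exists_mem_closure_rank
    refine ⟨F.sup M, fun γ hγ => monotone_closure_rank (Finset.le_sup (f := M) hγ) (hM γ)⟩
  refine ⟨M, fun h hgen => (hmem h).mpr (hFV fun γ hγ => ?_)⟩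
  have h1 : h γ = h₀ γ := eq_of_mem_closure_rank hgen (hM γ hγ)
  have h3 : h₀ γ ∈ u γ := (hu γ hγ).2
  have h4 : h γ ∈ u γ := h1.symm ▸ h3
  exact h4

/-- A homomorphism can be prescribed on finitely many generators, on the orbit of one generator
from some time on, and on the remaining generators. -/
theorem exists_hom_prescribed (h₀ : Pi1 →* G) (M : ℕ) (B C : ℕ → G) :
    ∃ h : Pi1 →* G, (∀ χ : Chart, χ.rank < M → h (gen χ) = h₀ (gen χ)) ∧
      (∀ n, M < n → h (orb n) = B n) ∧ ∀ k, M ≤ k → h (gen (.horizontal k)) = C k := by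
  -- The vertical generators of rank below `M` involve only `orb 1`, …, `orb M`, so the values of
  -- `h₀` are kept up to and including `M`.
  set A : ℕ → G := fun n => if n ≤ M then h₀ (orb n) else B n with hA
  let w : Chart → G := fun χ => match χ with
    | .interior => 1
    | .vertical k => (A (k + 1))⁻¹ * lprod A k
    | .horizontal k => if k < M then h₀ (gen (.horizontal k)) else C k
  obtain ⟨h, hh⟩ := exists_hom w rfl
  -- The values `w` on the vertical edges were read off from `gen_vertical_eq`; solving that formula
  -- for `orb (k + 1)` recovers `A` by strong induction.
  have h1 : ∀ n, 1 ≤ n → h (orb n) = A n := by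
    intro n
    induction n using Nat.strong_induction_on with
    | _ n ih =>
      intro hn
      obtain ⟨k, rfl⟩ : ∃ k, n = k + 1 := ⟨n - 1, by omega⟩
      have h2 := hh (.vertical k)
      rw [gen_vertical_eq, map_mul, map_inv, map_lprod,
        lprod_congr (B := A) fun n h1 h2 => ih n (by omega) h1] at h2
      exact inv_injective (mul_right_cancel h2)
  refine ⟨h, fun χ hχ => ?_, fun n hn => ?_, fun k hk => ?_⟩
  · cases χ with
    | interior => rw [gen_interior, map_one, map_one]
    | vertical k =>
      have hk : k < M := hχ
      have h3 : ∀ n, n ≤ k + 1 → A n = h₀ (orb n) := fun n hn => if_pos (by omega)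
      rw [hh, gen_vertical_eq, map_mul, map_inv, map_lprod, ← h3 _ le_rfl,
        ← lprod_congr fun n h1 h2 => h3 n (by omega)]
    | horizontal k =>
      rw [hh]
      exact if_pos hχ
  · rw [h1 n (by omega)]
    exact if_neg (by omega)
  · rw [hh]
    exact if_neg (by omega)

/-- Lifted reference paths connect every point to the fibre over the basepoint, and lifted loops
connect the points of that fibre. -/
theorem IsCoverOf.pathConnectedSpace {E : Type*} [TopologicalSpace E] {p : E → Surface}
    {h : Pi1 →* Equiv.Perm (Fin d)} (hp : IsCoverOf p h) [Nonempty (Fin d)]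
    (ht : ∀ i j, ∃ γ, h γ i = j) : PathConnectedSpace E := by
  obtain ⟨cov, label, hl⟩ := hp
  have hj : ∀ {x y : Surface} (q : Path.Homotopic.Quotient x y) (e : p ⁻¹' {x}),
      Joined (e : E) (cov.monodromy q e) := by
    intro x y q e
    obtain ⟨c, -⟩ := Path.Homotopic.Quotient.mk_surjective (cov.liftPathQuotient q e)
    exact ⟨c⟩
  obtain ⟨i⟩ := ‹Nonempty (Fin d)›
  have hb : ∀ x : E, Joined x (label i) := by
    intro x
    have h1 := hj (Path.Homotopic.Quotient.mk (toPoint (p x)).symm) ⟨x, rfl⟩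
    obtain ⟨j, hj'⟩ := label.surjective
      (cov.monodromy (Path.Homotopic.Quotient.mk (toPoint (p x)).symm) ⟨x, rfl⟩)
    obtain ⟨γ, hγ⟩ := ht j i
    have h2 := hj (FundamentalGroup.toPath γ) (label j)
    have h3 := hl γ j
    rw [hγ] at h3
    rw [← h3]
    rw [← hj'] at h1
    exact h1.trans h2
  exact ⟨⟨label i⟩, fun x y => (hb x).trans (hb y).symm⟩

theorem isConnectedCover_of_transitive [Nonempty (Fin d)] (h : Pi1 →* Equiv.Perm (Fin d))
    (ht : ∀ i j, ∃ γ, h γ i = j) : IsConnectedCover h := by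
  obtain ⟨E, hE, p, hp⟩ := exists_isCoverOf h
  have := hp.pathConnectedSpace ht
  exact ⟨E, hE, p, hp, inferInstance⟩

theorem exists_dense_covers [Nonempty (Fin d)] (hG : MulAction.IsPretransitive G (Fin d))
    {H : Subgroup (Equiv.Perm (Fin d))} (hHG : H ≤ G) :
    ∃ D : Set (Cov G), Dense D ∧
      ∀ h : Pi1 →* G, Cov.mk h ∈ D →
        IsConnectedCover (G.subtype.comp h) ∧
        (∀ c : Cov G, MapClusterPt c atTop (fun n => Cov.mk (iter h n)) → c ∈ covIn G H) ∧
        (∀ c : Cov G, MapClusterPt c atTop (fun n => Cov.mk (iter h n)) →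
          ∀ H' : Subgroup (Equiv.Perm (Fin d)), H' < H → c ∉ covIn G H') := by
  -- A class belongs to `D` if some representative has transitive monodromy and eventually visits
  -- exactly the elements of `H` along the orbit, each with bounded gaps. Another representative has
  -- the same sequence of classes, so its accumulation points are the same.
  refine ⟨{c | ∃ h : Pi1 →* G, Cov.mk h = c ∧
    (∀ i j, ∃ γ, (h γ : Equiv.Perm (Fin d)) i = j) ∧
    ∃ N L, (∀ n, N ≤ n → (h (orb n) : Equiv.Perm (Fin d)) ∈ H) ∧
      ∀ n, N ≤ n → ∀ g ∈ H, ∃ j ≤ L, (h (orb (n + j)) : Equiv.Perm (Fin d)) = g}, ?_, ?_⟩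
  · rw [dense_iff_inter_open]
    rintro U hU ⟨c, hc⟩
    induction c using Quotient.ind with | _ h₀
    obtain ⟨M, hM⟩ := exists_rank_of_isOpen (U := Cov.mk ⁻¹' U)
      (hU.preimage continuous_quot_mk) (h₀ := h₀) hc
    obtain ⟨B, L, hB⟩ := exists_periodic H
    obtain ⟨C, L', hC⟩ := exists_periodic G
    obtain ⟨h, h1, h2, h3⟩ := exists_hom_prescribed h₀ M (fun n => ⟨B n, hHG (B n).2⟩) C
    refine ⟨Cov.mk h, hM h h1, h, rfl, fun i j => ?_, M + 1, L, fun n hn => ?_,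
      fun n hn g hg => ?_⟩
    · obtain ⟨g, hg⟩ := hG.exists_smul_eq i j
      obtain ⟨m, -, hm⟩ := hC M g
      refine ⟨gen (.horizontal (M + m)), ?_⟩
      rw [h3 _ (Nat.le_add_right _ _), hm]
      exact hg
    · rw [h2 n hn]
      exact (B n).2
    · obtain ⟨j, hj, hjg⟩ := hB n ⟨g, hg⟩
      refine ⟨j, hj, ?_⟩
      rw [h2 (n + j) (by omega)]
      simp [hjg]
  · rintro h ⟨h', hh', ht, N, L, hN, hL⟩
    obtain ⟨σ, hσ⟩ := cov_eq_iff.mp hh'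
    have hi : ∀ n, Cov.mk (iter h n) = Cov.mk (iter h' n) := fun n =>
      (cov_eq_iff.mpr ⟨σ, fun γ => by rw [iter_apply, iter_apply, hσ]⟩).symm
    simp only [hi]
    refine ⟨isConnectedCover_of_transitive _ fun i j => ?_,
      fun c hc => mem_covIn_of_cluster hHG hN hc,
      fun c hc H' hH' => notMem_covIn_of_cluster hH' hL hc⟩
    obtain ⟨γ, hγ⟩ := ht (σ⁻¹ i) (σ⁻¹ j)
    refine ⟨γ, ?_⟩
    change (h γ : Equiv.Perm (Fin d)) i = j
    rw [hσ, Equiv.Perm.mul_apply, Equiv.Perm.mul_apply, hγ]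
    exact σ.apply_symm_apply j

/-! ### Labels of the points of a cover -/

section Labels

variable {d : ℕ} {E : Type*} [TopologicalSpace E] {p : E → Surface} (cov : IsCoveringMap p)
  (label : Fin d ≃ p ⁻¹' {basepoint})

theorem monodromy_symm_apply {x y : Surface} (c : Path x y) (e : p ⁻¹' {x}) :
    cov.monodromy (Path.Homotopic.Quotient.mk c.symm)
      (cov.monodromy (Path.Homotopic.Quotient.mk c) e) = e := by
  rw [← cov.monodromy_trans_apply, ← Path.Homotopic.Quotient.mk_trans,
    ← Path.Homotopic.Quotient.eq.mpr ⟨Path.Homotopy.reflTransSymm c⟩]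
  exact congrFun cov.monodromy_refl e

theorem monodromy_apply_symm {x y : Surface} (c : Path x y) (e : p ⁻¹' {y}) :
    cov.monodromy (Path.Homotopic.Quotient.mk c)
      (cov.monodromy (Path.Homotopic.Quotient.mk c.symm) e) = e := by
  have := monodromy_symm_apply cov c.symm e
  rwa [Path.symm_symm] at this

/-- The label of a point of a cover, transported to the fiber over the basepoint. -/
def coverLabel (x : E) : Fin d :=
  label.symm (cov.monodromy (Path.Homotopic.Quotient.mk (toPoint (p x)).symm) ⟨x, rfl⟩)

theorem coverLabel_eq {s : Surface} (e : p ⁻¹' {s}) : coverLabel cov label e =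
    label.symm (cov.monodromy (Path.Homotopic.Quotient.mk (toPoint s).symm) e) := by
  obtain ⟨e, rfl⟩ := e
  rfl

/-- The point of the cover with a given label over a given point. -/
def pointOf (i : Fin d) (s : Surface) : E :=
  cov.monodromy (Path.Homotopic.Quotient.mk (toPoint s)) (label i)

theorem proj_pointOf (i : Fin d) (s : Surface) : p (pointOf cov label i s) = s :=
  (cov.monodromy (Path.Homotopic.Quotient.mk (toPoint s)) (label i)).2

theorem coverLabel_pointOf (i : Fin d) (s : Surface) :
    coverLabel cov label (pointOf cov label i s) = i := by
  rw [pointOf, coverLabel_eq, monodromy_symm_apply, Equiv.symm_apply_apply]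

theorem pointOf_coverLabel {x : E} {s : Surface} (hs : p x = s) :
    pointOf cov label (coverLabel cov label x) s = x := by
  subst hs
  rw [pointOf, coverLabel, Equiv.apply_symm_apply, monodromy_apply_symm]

variable {cov label} {h : Pi1 →* Equiv.Perm (Fin d)}

/-- Labels are read by transport along the reference paths, and these are what `loop` uses to close
up `c`. -/
theorem coverLabel_monodromy
    (hl : ∀ (γ : Pi1) (i : Fin d), cov.monodromyPerm basepoint γ (label i) = label (h γ i))
    {x y : Surface} (c : Path x y) (e : p ⁻¹' {x}) :
    coverLabel cov label (cov.monodromy (Path.Homotopic.Quotient.mk c) e) =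
      h (loop c) (coverLabel cov label e) := by
  have h1 := hl (loop c) (coverLabel cov label e)
  rw [coverLabel_eq, Equiv.symm_apply_eq, ← h1, coverLabel_eq, Equiv.apply_symm_apply, loop]
  simp only [IsCoveringMap.coe_monodromyPerm, Path.Homotopic.Quotient.mk_trans,
    IsCoveringMap.monodromy_trans_apply]
  rw [monodromy_apply_symm]

theorem coverLabel_path
    (hl : ∀ (γ : Pi1) (i : Fin d), cov.monodromyPerm basepoint γ (label i) = label (h γ i))
    {x y : E} (c : Path x y) :
    coverLabel cov label y = h (loop (c.map cov.continuous)) (coverLabel cov label x) := by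
  have h1 := coverLabel_monodromy hl (c.map cov.continuous) ⟨x, rfl⟩
  have h2 : (cov.monodromy (Path.Homotopic.Quotient.mk (c.map cov.continuous)) ⟨x, rfl⟩ : E) = y :=
    congrArg Subtype.val (cov.monodromy_map (Path.Homotopic.Quotient.mk c))
  rw [h2] at h1
  exact h1

/-- The domain is contractible, so the parametrization lifts. The lift is a local homeomorphism
because both its projection and `p` are. -/
theorem exists_section (cov : IsCoveringMap p) {x : E} {χ : Chart} {z : ℝ × ℝ} (hz : z ∈ χ.dom)
    (hx : χ.param z = p x) : ∃ σ : χ.dom → E, Continuous σ ∧ IsOpenMap σ ∧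
      (∀ z', p (σ z') = χ.param z') ∧ σ ⟨z, hz⟩ = x := by
  have : ContractibleSpace χ.dom := χ.convex_dom.contractibleSpace χ.nonempty_dom
  have : LocallyPathConnectedSpace χ.dom := χ.isOpen_dom.locallyPathConnectedSpace
  let f : C(χ.dom, Surface) := ⟨fun z => χ.param z,
    continuousOn_iff_continuous_domRestrict.mp χ.continuousOn_param⟩
  obtain ⟨F, ⟨hF, hpF⟩, -⟩ := cov.existsUnique_continuousMap_lifts f ⟨z, hz⟩ x hx.symm
  have hf : IsOpenEmbedding f := χ.homeo.isOpenEmbedding_restrict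
  refine ⟨F, F.continuous, ?_, fun z' => congrFun hpF z', hF⟩
  refine (IsLocalHomeomorph.of_comp (g := p) (f := F) ?_ cov.isLocalHomeomorph
    F.continuous).isOpenMap
  rw [hpF]
  exact hf.isLocalHomeomorph

theorem coverLabel_section
    (hl : ∀ (γ : Pi1) (i : Fin d), cov.monodromyPerm basepoint γ (label i) = label (h γ i))
    {χ : Chart} {σ : χ.dom → E} (hσ : Continuous σ) (hp : ∀ z', p (σ z') = χ.param z')
    (z z' : χ.dom) : coverLabel cov label (σ z') =
      h (χ.jump gen z' * (χ.jump gen z)⁻¹) (coverLabel cov label (σ z)) := by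
  have : ContractibleSpace χ.dom := χ.convex_dom.contractibleSpace χ.nonempty_dom
  have c := PathConnectedSpace.somePath z z'
  rw [coverLabel_path hl (c.map hσ), loop_of_chart z.2 z'.2 _ (hp z).symm (hp z').symm fun t =>
    ⟨c t, (c t).2, (hp (c t)).symm⟩]

end Labels

/-! ### Horizontal trajectories -/

/-- The complement of the horizontal edges. -/
def offHorizontal : Set Surface := Chart.interior.carrier ∪ ⋃ k, (Chart.vertical k).carrier

theorem mem_offHorizontal_or {χ : Chart} {z : ℝ × ℝ} (hz : z ∈ χ.dom) :
    χ.param z ∈ offHorizontal ∨ ∃ k, χ = .horizontal k ∧ z.2 = 1 := by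
  cases χ with
  | interior => exact Or.inl (Or.inl ⟨z, hz, rfl⟩)
  | vertical k => exact Or.inl (Or.inr (mem_iUnion.mpr ⟨k, z, hz, rfl⟩))
  | horizontal k =>
    rcases lt_trichotomy z.2 1 with h | h | h
    · exact Or.inl (Or.inl ((Chart.param_mem_interior_iff hz).mpr (Or.inl h)))
    · exact Or.inr ⟨k, rfl, h⟩
    · exact Or.inl (Or.inl ((Chart.param_mem_interior_iff hz).mpr (Or.inr h)))

theorem notMem_offHorizontal {k : ℕ} {z : ℝ × ℝ} (hz : z ∈ (Chart.horizontal k).dom)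
    (h : z.2 = 1) : (Chart.horizontal k).param z ∉ offHorizontal := by
  have hi : (Chart.horizontal k).param z ∉ Chart.interior.carrier := by
    rw [Chart.param_mem_interior_iff hz]
    rintro (h' | h')
    · exact (ne_of_lt h') h
    · exact (ne_of_gt h') h
  rintro (h' | h')
  · exact hi h'
  · obtain ⟨j, hj⟩ := mem_iUnion.mp h'
    cases Chart.eq_of_mem_of_notMem_interior hj (Chart.param_mem hz) hi

section Invariant

variable {d : ℕ} {E : Type*} [TopologicalSpace E] {p : E → Surface} (cov : IsCoveringMap p)
  (label : Fin d ≃ p ⁻¹' {basepoint})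

/-- The points off the horizontal edges with labels in a given set. -/
def labelled (O : Set (Fin d)) : Set E := {x | p x ∈ offHorizontal ∧ coverLabel cov label x ∈ O}

variable {cov label} {h : Pi1 →* Equiv.Perm (Fin d)}
  (hl : ∀ (γ : Pi1) (i : Fin d), cov.monodromyPerm basepoint γ (label i) = label (h γ i))
  {O : Set (Fin d)} (hO : ∀ k i, h (gen (.vertical k)) i ∈ O ↔ i ∈ O)

include hl hO

/-- Off the horizontal edges there is a neighbourhood in the open square or in a vertical chart,
where labels change at most by some `h(v_k)` or its inverse; these preserve `O`. -/
theorem eventually_mem_labelled {x : E} (hx : p x ∈ offHorizontal) :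
    ∀ᶠ x' in 𝓝 x, x' ∈ labelled cov label O ↔ x ∈ labelled cov label O := by
  obtain ⟨χ, hχ, hc, hgen⟩ : ∃ χ : Chart, p x ∈ χ.carrier ∧ χ.carrier ⊆ offHorizontal ∧
      ∀ i, h (gen χ) i ∈ O ↔ i ∈ O := by
    rcases id hx with hx | hx
    · exact ⟨_, hx, subset_union_left, by rw [gen_interior, map_one]; exact fun i => Iff.rfl⟩
    · obtain ⟨k, hk⟩ := mem_iUnion.mp hx
      exact ⟨_, hk, (subset_iUnion (fun k => (Chart.vertical k).carrier) k).trans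
        subset_union_right, hO k⟩
  obtain ⟨z, hz, hzx⟩ := hχ
  obtain ⟨σ, hσ, hop, hpσ, hσx⟩ := exists_section cov hz hzx
  have hj : ∀ z i, h (χ.jump gen z) i ∈ O ↔ i ∈ O := by
    intro z i
    rw [Chart.jump]
    split_ifs
    · exact hgen i
    · rw [map_one]
      rfl
  have hj' : ∀ z i, (h (χ.jump gen z))⁻¹ i ∈ O ↔ i ∈ O := by
    intro z i
    rw [← hj z ((h (χ.jump gen z))⁻¹ i)]
    exact iff_of_eq (congrArg (· ∈ O) ((h (χ.jump gen z)).apply_symm_apply i))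
  filter_upwards [hσx ▸ hop.range_mem_nhds ⟨z, hz⟩] with x' hx'
  obtain ⟨z', rfl⟩ := hx'
  have h1 : p (σ z') ∈ offHorizontal := hpσ z' ▸ hc (Chart.param_mem z'.2)
  have h2 := coverLabel_section hl hσ hpσ ⟨z, hz⟩ z'
  rw [hσx, map_mul, map_inv, Equiv.Perm.mul_apply] at h2
  have h3 : coverLabel cov label (σ z') ∈ O ↔ coverLabel cov label x ∈ O := by
    rw [h2, hj, hj']
  exact and_congr (iff_of_true h1 hx) h3

theorem isOpen_labelled : IsOpen (labelled cov label O) := by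
  rw [isOpen_iff_mem_nhds]
  intro x hx
  filter_upwards [eventually_mem_labelled hl hO hx.1] with x' hx'
  exact hx'.mpr hx

/-- Membership is locally constant in time, hence constant on the connected interval. -/
theorem mem_labelled_of_flowsTo {T : ℝ} {x y : E} (hf : FlowsTo p T x y) :
    x ∈ labelled cov label O ↔ y ∈ labelled cov label O := by
  classical
  obtain ⟨hT, c, hc, hh, rfl, rfl⟩ := hf
  have hcont : ContinuousOn (fun t => decide (c t ∈ labelled cov label O)) (Icc 0 T) := by
    intro t ht
    have key : ∀ᶠ s in 𝓝[Icc 0 T] t, c s ∈ labelled cov label O ↔ c t ∈ labelled cov label O := by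
      by_cases hx : p (c t) ∈ offHorizontal
      · exact (hc t ht).eventually (eventually_mem_labelled hl hO hx)
      -- A trajectory on a horizontal edge runs along it, so it remains outside the set at nearby
      -- times.
      · obtain ⟨χ, z, hz, hs⟩ := hh t ht
        have h0 := hs.self_of_nhdsWithin ht
        simp only [Function.comp_apply, sub_self, add_zero] at h0
        rcases mem_offHorizontal_or hz with h1 | ⟨k, rfl, h1⟩
        · exact (hx (h0 ▸ h1)).elim
        · have h2 : ContinuousAt (fun s => (z.1 + (s - t), z.2)) t := by fun_prop
          have h3 : ∀ᶠ s in 𝓝 t, (z.1 + (s - t), z.2) ∈ (Chart.horizontal k).dom := by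
            refine h2.preimage_mem_nhds ((Chart.isOpen_dom _).mem_nhds ?_)
            simpa using hz
          filter_upwards [hs, h3.filter_mono nhdsWithin_le_nhds] with s hs hd
          refine iff_of_false (fun h => ?_) fun h => hx h.1
          exact notMem_offHorizontal hd h1 (hs ▸ h.1)
    refine ContinuousWithinAt.congr_of_eventuallyEq
      (f := fun _ => decide (c t ∈ labelled cov label O)) continuousWithinAt_const ?_ rfl
    filter_upwards [key] with s hs
    simp only [hs]
  have := isPreconnected_Icc.constant hcont (left_mem_Icc.mpr hT) (right_mem_Icc.mpr hT)
  simpa using this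

end Invariant

/-! ### Transport by the affine automorphism -/

section Transport

variable {d : ℕ} {E : Type*} [TopologicalSpace E] {p : E → Surface}

/-- A lift of `c` through `φ ∘ p` is the same curve as a lift of `φ⁻¹ ∘ c` through `p`. -/
theorem monodromy_phi_comp (cov : IsCoveringMap p) (cov' : IsCoveringMap (phi ∘ p)) {x y : Surface}
    (c : Path x y) (e : (phi ∘ p) ⁻¹' {x}) (e' : p ⁻¹' {phi.symm x}) (he : (e : E) = e') :
    (cov'.monodromy (Path.Homotopic.Quotient.mk c) e : E) =
      cov.monodromy (Path.Homotopic.Quotient.mk (c.map phi.symm.continuous)) e' := by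
  have hs' : c.map phi.symm.continuous 0 = p e' := (Path.source _).trans e'.2.symm
  have h1 : cov.liftPath (c.map phi.symm.continuous) e' hs' =
      cov'.liftPath c e (c.source.trans e.2.symm) := by
    rw [cov'.eq_liftPath_iff']
    refine ⟨?_, ?_⟩
    · have h2 := cov.liftPath_lifts (c.map phi.symm.continuous) e' hs'
      funext t
      have h3 := congrFun h2 t
      exact (congrArg phi h3).trans (phi.apply_symm_apply _)
    · rw [he]
      exact cov.liftPath_zero _ _ _
  exact (DFunLike.congr_fun h1 1).symm

/-- The fibre of `φ ∘ p` over the basepoint is the fibre of `p` over its preimage. Labelling the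
latter by transport along `delta` produces exactly the conjugation by `δ` in `phiInvDelta`. -/
theorem IsCoverOf.phi_comp {h : Pi1 →* Equiv.Perm (Fin d)} (hp : IsCoverOf p h) :
    IsCoverOf (phi ∘ p) (h.comp phiInvDelta) := by
  obtain ⟨cov, label, hl⟩ := hp
  have cov' : IsCoveringMap (phi ∘ p) := cov.homeomorph_comp phi
  have hfib : ∀ x, p x = phi.symm basepoint ↔ (phi ∘ p) x = basepoint := fun x =>
    phi.eq_symm_apply (x := p x)
  let e : p ⁻¹' {basepoint} ≃ p ⁻¹' {phi.symm basepoint} :=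
    { toFun := cov.monodromy (Path.Homotopic.Quotient.mk delta)
      invFun := cov.monodromy (Path.Homotopic.Quotient.mk delta.symm)
      left_inv := monodromy_symm_apply cov delta
      right_inv := monodromy_apply_symm cov delta }
  let e' : p ⁻¹' {phi.symm basepoint} ≃ (phi ∘ p) ⁻¹' {basepoint} :=
    Equiv.setCongr (Set.ext hfib)
  refine ⟨cov', (label.trans e).trans e', fun γ i => ?_⟩
  obtain ⟨c, rfl⟩ := Path.Homotopic.Quotient.mk_surjective γ
  apply Subtype.ext
  have h1 := monodromy_phi_comp cov cov' c (e' (e (label i))) (e (label i)) rfl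
  have h2 := hl (phiInvDelta (FundamentalGroup.fromPath (Path.Homotopic.Quotient.mk c))) i
  rw [phiInvDelta_mk] at h2
  simp only [IsCoveringMap.coe_monodromyPerm, Path.Homotopic.Quotient.mk_trans,
    IsCoveringMap.monodromy_trans_apply] at h2
  have h3 := congrArg e h2
  refine h1.trans (congrArg Subtype.val ?_)
  refine Eq.trans ?_ h3
  exact (monodromy_apply_symm cov delta _).symm

theorem phi_param_aux {χ χ' : Chart} {R : Set (ℝ × ℝ)} (hR : IsOpen R) {f : ℝ × ℝ → ℝ × ℝ}
    (hf : ∀ z ∈ R, f z ∈ χ'.dom ∧ phi (χ.param z) = χ'.param (f z))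
    (hlin : ∀ z u, f (z.1 + 2 * u, z.2) = ((f z).1 + u, (f z).2)) {z : ℝ × ℝ} (hz : z ∈ R) :
    ∃ (χ' : Chart) (z' : ℝ × ℝ), z' ∈ χ'.dom ∧
      ∀ᶠ u : ℝ in 𝓝 0, phi (χ.param (z.1 + 2 * u, z.2)) = χ'.param (z'.1 + u, z'.2) := by
  refine ⟨χ', f z, (hf z hz).1, ?_⟩
  have h2 : ContinuousAt (fun u : ℝ => (z.1 + 2 * u, z.2)) 0 := by fun_prop
  have h3 : ∀ᶠ u : ℝ in 𝓝 0, (z.1 + 2 * u, z.2) ∈ R :=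
    h2.eventually (hR.mem_nhds (by simpa using hz))
  filter_upwards [h3] with u hu
  rw [(hf _ hu).2, hlin]

theorem phi_interior {z : ℝ × ℝ} (hz : z ∈ Chart.interior.dom) :
    (z.1 / 2, 2 * z.2) ∈ (Chart.horizontal 0).dom ∧
      phi (pt z) = (Chart.horizontal 0).param (z.1 / 2, 2 * z.2) := by
  have hz' : (z.1 / 2, 2 * z.2) ∈ (Chart.horizontal 0).dom := by
    obtain ⟨⟨h1, h2⟩, h3, h4⟩ := hz
    refine ⟨far_zero.mpr ?_, ?_, ?_⟩
    · simp only
      constructor <;> linarith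
    · simp only; linarith
    · simp only; linarith
  refine ⟨hz', ?_⟩
  rw [← phi.eq_symm_apply, (phi_symm_horizontal_zero hz').2]
  exact congrArg pt (by ext <;> simp only <;> ring)

/-- The map `φ` halves horizontal lengths, so a horizontal line run at speed 2 has an image of unit
speed. -/
theorem phi_horizontal_line {χ : Chart} {z : ℝ × ℝ} (hz : z ∈ χ.dom) :
    ∃ (χ' : Chart) (z' : ℝ × ℝ), z' ∈ χ'.dom ∧
      ∀ᶠ u : ℝ in 𝓝 0, phi (χ.param (z.1 + 2 * u, z.2)) = χ'.param (z'.1 + u, z'.2) := by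
  have hmain : ∀ {χ χ' : Chart} {w w' : ℝ × ℝ}, phi.symm (χ'.param w) = χ.param w' →
      phi (χ.param w') = χ'.param w := fun h => by rw [← h, phi.apply_symm_apply]
  cases χ with
  | interior =>
    exact phi_param_aux (χ := .interior) (Chart.isOpen_dom .interior)
      (fun z hz => phi_interior hz) (fun z u => by ext <;> simp only <;> ring) hz
  | vertical k =>
    cases k with
    | zero =>
      refine phi_param_aux (χ' := .interior) (f := fun z => (z.1 / 2, 2 * z.2))
        (Chart.isOpen_dom (.vertical 0)) (fun z hz => ?_)
        (fun z u => by ext <;> simp only <;> ring) hz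
      have hy := far_zero.mp hz.2
      have h1 : (z.1 / 2, 2 * z.2) ∈ Chart.interior.dom :=
        ⟨⟨by simp only; linarith [hz.1.1], by simp only; linarith [hz.1.2]⟩,
          by simp only; linarith, by simp only; linarith⟩
      refine ⟨h1, hmain ?_⟩
      rw [(phi_symm_interior h1).2]
      congr 1
      ext <;> simp only <;> ring
    | succ k =>
      refine phi_param_aux (χ' := .vertical k) (f := fun z => (z.1 / 2 + 1 / 2, 2 * z.2 - 1))
        (Chart.isOpen_dom (.vertical (k + 1))) (fun z hz => ?_)
        (fun z u => by ext <;> simp only <;> ring) hz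
      have hx := hz.1
      have h1 : (z.1 / 2 + 1 / 2, 2 * z.2 - 1) ∈ (Chart.vertical k).dom :=
        ⟨⟨by simp only; linarith [hz.1.1], by simp only; linarith [hz.1.2]⟩, far_pred hz.2⟩
      refine ⟨h1, hmain ?_⟩
      rw [(phi_symm_vertical h1 (by simp only; linarith [hz.1.1])
        (by simp only; linarith [hz.1.2])).2]
      congr 1
      ext <;> simp only <;> ring
  | horizontal k =>
    -- The image of a horizontal chart need not fit into one chart: below and above the edge the
    -- chart is part of the open square, and near the edge it goes to the next horizontal chart.
    rcases lt_trichotomy z.2 1 with h | h | h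
    · refine phi_param_aux (χ' := .horizontal 0) (f := fun z => (z.1 / 2, 2 * z.2))
        ((Chart.isOpen_dom (.horizontal k)).inter (Chart.isOpen_before (.horizontal k)))
        (fun z hz => ?_) (fun z u => by ext <;> simp only <;> ring) ⟨hz, h⟩
      have h1 := Chart.param_before hz.1 hz.2
      rw [h1.2]
      exact phi_interior h1.1
    · refine phi_param_aux (χ' := .horizontal (k + 1))
        (f := fun z => (z.1 / 2 + 1 / 2, 2 * z.2 - 1))
        (R := farInterval k ×ˢ Ioo (1 / 2) (3 / 2)) (isOpen_Ioo.prod isOpen_Ioo) (fun z hz => ?_)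
        (fun z u => by ext <;> simp only <;> ring) ⟨hz.1, by rw [h]; norm_num⟩
      have h1 : (z.1 / 2 + 1 / 2, 2 * z.2 - 1) ∈ (Chart.horizontal (k + 1)).dom :=
        ⟨far_succ.mpr hz.1, by simp only; linarith [hz.2.1], by simp only; linarith [hz.2.2]⟩
      refine ⟨h1, hmain ?_⟩
      rw [(phi_symm_horizontal_succ h1).2]
      congr 1
      ext <;> simp only <;> ring
    · refine phi_param_aux (χ' := .horizontal 0)
        (f := fun z => ((z.1 + shift k) / 2, 2 * (z.2 - 1)))
        ((Chart.isOpen_dom (.horizontal k)).inter (Chart.isOpen_beyond (.horizontal k)))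
        (fun z hz => ?_) (fun z u => by ext <;> simp only <;> ring) ⟨hz, h⟩
      have h1 := Chart.param_beyond hz.1 hz.2
      rw [h1.2]
      exact phi_interior h1.1

theorem FlowsTo.phi_comp {T : ℝ} {x y : E} (hf : FlowsTo p T x y) :
    FlowsTo (phi ∘ p) (T / 2) x y := by
  obtain ⟨hT, c, hc, hh, h0, h1⟩ := hf
  have hmaps : MapsTo (fun t : ℝ => 2 * t) (Icc 0 (T / 2)) (Icc 0 T) := fun t ht =>
    ⟨by simp only; linarith [ht.1], by simp only; linarith [ht.2]⟩
  refine ⟨by linarith, fun t => c (2 * t), hc.comp (by fun_prop) hmaps, ?_, by simpa using h0,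
    by simpa [mul_div_cancel₀] using h1⟩
  intro t ht
  obtain ⟨χ, z, hz, hs⟩ := hh (2 * t) (hmaps ht)
  obtain ⟨χ', z', hz', hs'⟩ := phi_horizontal_line hz
  refine ⟨χ', z', hz', ?_⟩
  have h2 : Tendsto (fun s : ℝ => 2 * s) (𝓝[Icc 0 (T / 2)] t) (𝓝[Icc 0 T] (2 * t)) :=
    (by fun_prop : Continuous fun s : ℝ => 2 * s).continuousWithinAt.tendsto_nhdsWithin hmaps
  have h3 : Tendsto (fun s : ℝ => s - t) (𝓝[Icc 0 (T / 2)] t) (𝓝 0) := by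
    have : ContinuousAt (fun s : ℝ => s - t) t := by fun_prop
    have h4 := this.tendsto
    rw [sub_self] at h4
    exact h4.mono_left nhdsWithin_le_nhds
  filter_upwards [h2.eventually hs, h3.eventually hs'] with s hs hs'
  rw [← hs']
  simp only [Function.comp_apply] at hs ⊢
  rw [hs]
  congr 3
  ring

end Transport

/-! ### Measures -/

theorem Chart.dom_subset_square : Chart.interior.dom ⊆ square := fun _ hz => Or.inl hz

theorem square_ae_eq : square =ᵐ[volume] Chart.interior.dom := by
  have h1 : Chart.interior.dom =ᵐ[volume] (Icc 0 1 ×ˢ Icc 0 1 : Set (ℝ × ℝ)) :=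
    Measure.set_prod_ae_eq Ioo_ae_eq_Icc Ioo_ae_eq_Icc
  have h2 : square ⊆ Icc 0 1 ×ˢ Icc 0 1 := fun z hz => by
    obtain ⟨h1, h2, h3, h4⟩ := square_bounds hz
    exact ⟨⟨h1, h2⟩, h3, h4⟩
  exact EventuallyLE.antisymm (h2.eventuallyLE.trans h1.symm.le)
    Chart.dom_subset_square.eventuallyLE

theorem area_eq : area = (volume.restrict Chart.interior.dom).map pt := by
  rw [area, Measure.restrict_congr_set square_ae_eq]

theorem aemeasurable_pt : AEMeasurable pt (volume.restrict Chart.interior.dom) :=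
  (continuousOn_pt.mono Chart.dom_subset_square).aemeasurable
    (Chart.isOpen_dom .interior).measurableSet

theorem area_apply {U : Set Surface} (hU : MeasurableSet U) :
    area U = volume.restrict Chart.interior.dom (pt ⁻¹' U) := by
  rw [area_eq, Measure.map_apply_of_aemeasurable aemeasurable_pt hU]

theorem ae_mem_interior : ∀ᵐ s ∂area, s ∈ Chart.interior.carrier := by
  have hm := (Chart.isOpen_carrier .interior).measurableSet
  rw [area_eq]
  refine (ae_map_iff aemeasurable_pt hm).mpr ?_
  filter_upwards [ae_restrict_mem (Chart.isOpen_dom .interior).measurableSet] with z hz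
  exact Chart.param_mem (χ := .interior) hz

theorem restrict_area : area.restrict Chart.interior.carrier = area :=
  Measure.restrict_eq_self_of_ae_mem ae_mem_interior

theorem area_pos {U : Set Surface} (hU : IsOpen U) (hU' : U ⊆ Chart.interior.carrier)
    (hne : U.Nonempty) : area U ≠ 0 := by
  have h1 : IsOpen (Chart.interior.dom ∩ pt ⁻¹' U) :=
    (continuousOn_pt.mono Chart.dom_subset_square).isOpen_inter_preimage
      (Chart.isOpen_dom .interior) hU
  obtain ⟨s, hs⟩ := hne
  obtain ⟨z, hz, rfl⟩ := hU' hs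
  have h2 := (h1.measure_pos volume ⟨z, hz, hs⟩).ne'
  rw [area_apply hU.measurableSet]
  refine fun h => h2 ?_
  rw [inter_comm]
  exact le_antisymm ((Measure.le_restrict_apply _ _).trans h.le) zero_le

/-- Makes the fibres over the open square closed, hence measurable for the counting measure. -/
theorem isClosed_singleton_interior {s : Surface} (hs : s ∈ Chart.interior.carrier) :
    IsClosed ({s} : Set Surface) := by
  obtain ⟨z, hz, rfl⟩ := hs
  refine ⟨isOpen_of_saturated (X := {z}ᶜ) isClosed_singleton.isOpen_compl fun w hw => ?_⟩
  have := pt_mem_interior_image (V := {z}) (singleton_subset_iff.mpr hz) hw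
  rw [image_singleton] at this
  exact not_congr this

section CoverArea

variable {d : ℕ} {E : Type*} [TopologicalSpace E] {p : E → Surface} {cov : IsCoveringMap p}
  {label : Fin d ≃ p ⁻¹' {basepoint}} {h : Pi1 →* Equiv.Perm (Fin d)}

/-- The continuous section over the open square through one point with label `i` keeps this label,
and a point is determined by its label and its projection. -/
theorem continuousOn_pointOf
    (hl : ∀ (γ : Pi1) (i : Fin d), cov.monodromyPerm basepoint γ (label i) = label (h γ i))
    (i : Fin d) : ContinuousOn (pointOf cov label i) Chart.interior.carrier := by
  obtain ⟨z, hz⟩ := Chart.nonempty_dom .interior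
  obtain ⟨σ, hσ, -, hpσ, hσx⟩ := exists_section cov (χ := .interior) hz
    (proj_pointOf cov label i _).symm
  have key : ∀ w : Chart.interior.dom, pointOf cov label i (Chart.interior.param w) = σ w := by
    intro w
    have h1 := coverLabel_section hl hσ hpσ ⟨z, hz⟩ w
    have h2 : ∀ z, Chart.interior.jump gen z = 1 := fun _ => if_neg id
    rw [hσx, coverLabel_pointOf, h2, h2, inv_one, mul_one, map_one] at h1
    have h3 := pointOf_coverLabel cov label (hpσ w)
    rw [h1] at h3
    exact h3
  have hs : ContinuousOn Chart.interior.homeo.symm Chart.interior.carrier :=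
    Chart.interior.homeo.continuousOn_symm
  have hm : ∀ s : Chart.interior.carrier, Chart.interior.homeo.symm s ∈ Chart.interior.dom :=
    fun s => Chart.interior.homeo.map_target s.2
  rw [continuousOn_iff_continuous_domRestrict] at hs ⊢
  refine (hσ.comp (hs.subtype_mk hm)).congr fun s => ?_
  refine (key ⟨_, hm s⟩).symm.trans ?_
  exact congrArg (pointOf cov label i) (Chart.interior.homeo.right_inv s.2)

variable [MeasurableSpace E] [BorelSpace E]

theorem count_restrict_fiber {s : Surface} (cov : IsCoveringMap p)
    (label : Fin d ≃ p ⁻¹' {basepoint}) (hs : s ∈ Chart.interior.carrier) :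
    Measure.count.restrict (p ⁻¹' {s}) = ∑ i, Measure.dirac (pointOf cov label i s) := by
  classical
  have hm : MeasurableSet (p ⁻¹' {s}) :=
    ((isClosed_singleton_interior hs).preimage cov.continuous).measurableSet
  ext B hB
  have hB' : B ∩ p ⁻¹' {s} =
      (fun i => pointOf cov label i s) '' (Finset.univ.filter fun i => pointOf cov label i s ∈ B) := by
    ext x
    constructor
    · rintro ⟨hx, hxs⟩
      have h1 := pointOf_coverLabel cov label hxs
      exact ⟨coverLabel cov label x, by simpa [h1] using hx, h1⟩
    · rintro ⟨i, hi, rfl⟩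
      exact ⟨by simpa using hi, proj_pointOf cov label i s⟩
  have hinj : Function.Injective fun i => pointOf cov label i s := fun i j hij => by
    rw [← coverLabel_pointOf cov label i s, ← coverLabel_pointOf cov label j s]
    exact congrArg _ hij
  rw [Measure.restrict_apply hB, Measure.count_apply (hB.inter hm), hB', hinj.encard_image,
    Set.encard_coe_eq_coe_finsetCard, Measure.finsetSum_apply]
  simp only [Measure.dirac_apply' _ hB, Set.indicator_apply, Pi.one_apply, Finset.sum_boole]
  simp

/-- `Measure.bind` is the expected integral once the kernel is almost everywhere measurable. Over
the open square, which has full area, the kernel is a finite sum of Dirac measures at continuously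
varying points. -/
theorem coverArea_apply
    (hl : ∀ (γ : Pi1) (i : Fin d), cov.monodromyPerm basepoint γ (label i) = label (h γ i))
    {B : Set E} (hB : MeasurableSet B) :
    coverArea p B = ∫⁻ s, Measure.count.restrict (p ⁻¹' {s}) B ∂area := by
  have h1 : ∀ i, AEMeasurable (pointOf cov label i) area := fun i => by
    rw [← restrict_area]
    exact (continuousOn_pointOf hl i).aemeasurable (Chart.isOpen_carrier _).measurableSet
  have h2 : AEMeasurable (fun s => ∑ i, Measure.dirac (pointOf cov label i s)) area :=
    Finset.aemeasurable_fun_sum _ fun i _ => Measure.measurable_dirac.comp_aemeasurable (h1 i)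
  refine Measure.bind_apply hB (h2.congr ?_)
  filter_upwards [ae_mem_interior] with s hs
  exact (count_restrict_fiber cov label hs).symm

/-- If every fibre over `U` meets `B`, the number of points of `B` in the fibre is at least the
indicator of `U`. -/
theorem coverArea_ne_zero
    (hl : ∀ (γ : Pi1) (i : Fin d), cov.monodromyPerm basepoint γ (label i) = label (h γ i))
    {B : Set E} (hB : MeasurableSet B) {U : Set Surface} (hU : IsOpen U)
    (hU' : U ⊆ Chart.interior.carrier) (hne : U.Nonempty)
    (hUB : ∀ s ∈ U, ∃ x ∈ B, p x = s) : coverArea p B ≠ 0 := by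
  rw [coverArea_apply hl hB]
  refine fun h0 => area_pos hU hU' hne (le_antisymm ?_ zero_le)
  rw [← h0, ← lintegral_indicator_one hU.measurableSet]
  refine lintegral_mono fun s => ?_
  by_cases hs : s ∈ U
  · obtain ⟨x, hx, hxs⟩ := hUB s hs
    rw [indicator_of_mem hs, Measure.restrict_apply hB, Pi.one_apply]
    refine le_trans ?_ Measure.le_count_apply
    exact ENNReal.le_tsum (f := fun _ => 1) (⟨x, hx, hxs⟩ : ↥(B ∩ p ⁻¹' {s}))
  · rw [indicator_of_notMem hs]
    exact zero_le

end CoverArea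

/-! ### Iterates of the affine automorphism -/

section Iterate

variable {d : ℕ} {G : Subgroup (Equiv.Perm (Fin d))} {E : Type*} [TopologicalSpace E]
  {p : E → Surface}

theorem IsCoverOf.iterate {h : Pi1 →* G} (hp : IsCoverOf p (G.subtype.comp h)) (n : ℕ) :
    IsCoverOf (phi^[n] ∘ p) (G.subtype.comp (iter h n)) := by
  induction n with
  | zero => exact hp
  | succ n ih =>
    have h1 : iter h (n + 1) = (iter h n).comp phiInvDelta := Function.iterate_succ_apply' _ _ _
    have h2 : phi^[n + 1] ∘ p = phi ∘ (phi^[n] ∘ p) := by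
      rw [Function.iterate_succ', Function.comp_assoc]
    rw [h1, h2]
    exact ih.phi_comp

theorem FlowsTo.iterate {T : ℝ} {x y : E} (hf : FlowsTo p T x y) (n : ℕ) :
    ∃ T', FlowsTo (phi^[n] ∘ p) T' x y := by
  induction n with
  | zero => exact ⟨T, hf⟩
  | succ n ih =>
    obtain ⟨T', hT'⟩ := ih
    rw [Function.iterate_succ', Function.comp_assoc]
    exact ⟨_, hT'.phi_comp⟩

/-- The point stays in the lower half of the square before each step, so only the first branch of
`φ` is applied. It shows that the open square meets its preimage under each iterate. -/
theorem phi_iterate_pt (n : ℕ) {y : ℝ} (hy : y ∈ Ioo (0 : ℝ) 1) :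
    phi^[n] (pt (1 / 2, y * (1 / 2) ^ n)) = pt ((1 / 2) ^ (n + 1), y) := by
  induction n generalizing y with
  | zero => norm_num
  | succ n ih =>
    have hy' : y / 2 ∈ Ioo (0 : ℝ) 1 := ⟨by linarith [hy.1], by linarith [hy.2]⟩
    have h1 : y * (1 / 2 : ℝ) ^ (n + 1) = y / 2 * (1 / 2) ^ n := by ring
    have h2 : (((1 : ℝ) / 2) ^ (n + 1), y / 2) ∈ square :=
      interior_mem ⟨by positivity, pow_lt_one₀ (by norm_num) (by norm_num) (by omega)⟩ hy'
    rw [Function.iterate_succ_apply', h1, ih hy']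
    change phiFun _ = _
    rw [phiFun_pt h2, phiAux, if_pos (by simp only; linarith [hy.2])]
    congr 1
    ext <;> simp only <;> ring

theorem not_isErgodic [MeasurableSpace E] [BorelSpace E] {H : Subgroup (Equiv.Perm (Fin d))}
    (hH : ¬ MulAction.IsPretransitive H (Fin d)) {h : Pi1 →* G} {N : ℕ}
    (hN : ∀ k, (iter h N (gen (.vertical k)) : Equiv.Perm (Fin d)) ∈ H)
    (hp : IsCoverOf p (G.subtype.comp h)) : ¬ IsErgodic p := by
  obtain ⟨cov', label', hl'⟩ := hp.iterate N
  obtain ⟨cov, label, hl⟩ := hp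
  obtain ⟨i, j, hij⟩ : ∃ i j : Fin d, j ∉ MulAction.orbit H i := by
    by_contra! hc
    exact hH ⟨hc⟩
  have hO : ∀ k m, (G.subtype.comp (iter h N)) (gen (.vertical k)) m ∈ MulAction.orbit H i ↔
      m ∈ MulAction.orbit H i := fun k m => by
    change (⟨_, hN k⟩ : H) • m ∈ _ ↔ _
    rw [← MulAction.orbit_eq_iff, MulAction.orbit_smul, MulAction.orbit_eq_iff]
  -- The invariant set uses labels for `φᴺ ∘ p`, while its measure is taken with respect to `p`.
  have hA := isOpen_labelled hl' hO
  have hc : Continuous phi^[N] := phi.continuous.iterate N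
  -- Both sets are tested over base points `s` in the open square, where `area_pos` applies, such
  -- that `φᴺ s` is in the open square too, hence off the horizontal edges.
  have hU : IsOpen (Chart.interior.carrier ∩ phi^[N] ⁻¹' Chart.interior.carrier) :=
    (Chart.isOpen_carrier _).inter ((Chart.isOpen_carrier _).preimage hc)
  have hne : (Chart.interior.carrier ∩ phi^[N] ⁻¹' Chart.interior.carrier).Nonempty := by
    have h1 : (1 / 2 : ℝ) ∈ Ioo (0 : ℝ) 1 := by norm_num
    have h2 : ∀ n : ℕ, (1 / 2 : ℝ) ^ (n + 1) ∈ Ioo (0 : ℝ) 1 := fun n =>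
      ⟨by positivity, pow_lt_one₀ (by norm_num) (by norm_num) (by omega)⟩
    refine ⟨pt (1 / 2, 1 / 2 * (1 / 2) ^ N), ⟨_, ⟨h1, ?_⟩, rfl⟩, ?_⟩
    · simp only [← pow_succ']
      exact h2 N
    · rw [mem_preimage, phi_iterate_pt N h1]
      exact ⟨_, ⟨h2 N, h1⟩, rfl⟩
  have hover : ∀ m s, p (pointOf cov' label' m (phi^[N] s)) = s := fun m s =>
    (phi.injective.iterate N) (proj_pointOf cov' label' m _)
  intro herg
  rcases herg _ hA.measurableSet fun T x y hf => by
    obtain ⟨T', hf'⟩ := hf.iterate N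
    exact mem_labelled_of_flowsTo hl' hO hf' with h0 | h0
  -- Label `i` yields a point of the set over every such `s`; in the other case label `j`, outside
  -- the orbit of `i`, yields a point of the complement.
  · refine coverArea_ne_zero hl hA.measurableSet hU inter_subset_left hne (fun s hs => ?_) h0
    refine ⟨_, ⟨?_, ?_⟩, hover i s⟩
    · exact Or.inl ((proj_pointOf cov' label' i _).symm ▸ hs.2)
    · rw [coverLabel_pointOf]
      exact MulAction.mem_orbit_self i
  · refine coverArea_ne_zero hl hA.measurableSet.compl hU inter_subset_left hne (fun s hs => ?_) h0
    refine ⟨_, fun hm => hij ?_, hover j s⟩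
    have := hm.2
    rwa [coverLabel_pointOf] at this

end Iterate

end Chamanara

end

theorem mainTheorem10 (d : ℕ) (hd : 2 ≤ d) (G : Subgroup (Equiv.Perm (Fin d)))
    (hG : MulAction.IsPretransitive G (Fin d)) :
    (∀ h : Pi1 →* G,
      (∃ (E : Type) (_ : TopologicalSpace E) (p : E → Surface),
        IsCoverOf p (G.subtype.comp h)) ∧
      ∀ H : Subgroup (Equiv.Perm (Fin d)), H ≤ G → ¬ MulAction.IsPretransitive H (Fin d) →
        (∀ k : Pi1 →* G, MapClusterPt k atTop (iter h) → ValuedIn H k) →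
        ∀ (E : Type*) [TopologicalSpace E] [MeasurableSpace E] [BorelSpace E] (p : E → Surface),
          IsCoverOf p (G.subtype.comp h) → ¬ IsErgodic p) ∧
    (∀ H : Subgroup (Equiv.Perm (Fin d)), H ≤ G → ¬ MulAction.IsPretransitive H (Fin d) →
      ∃ D : Set (Cov G), Dense D ∧
        ∀ h : Pi1 →* G, Cov.mk h ∈ D →
          IsConnectedCover (G.subtype.comp h) ∧
          (∀ c : Cov G, MapClusterPt c atTop (fun n => Cov.mk (iter h n)) → c ∈ covIn G H) ∧
          (∀ c : Cov G, MapClusterPt c atTop (fun n => Cov.mk (iter h n)) →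
            ∀ H' : Subgroup (Equiv.Perm (Fin d)), H' < H → c ∉ covIn G H')) := by
  have : Nonempty (Fin d) := ⟨⟨0, by omega⟩⟩
  refine ⟨fun h => ⟨exists_isCoverOf _, fun H _ hH hk E _ _ _ p hp => ?_⟩,
    fun H hHG _ => exists_dense_covers hG hHG⟩
  obtain ⟨N, hN⟩ := exists_forall_orb_mem hk
  exact not_isErgodic hH (iter_gen_vertical_mem hN) hp
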